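/- **Setting.** Let $B$ be a $\sigma$-unital $C^*$-algebra and let $X$ be a countably generated Hilbert $C^*$-module over $B$, with $C^*$-algebra $\mathbb{L}(X)$ of bounded adjointable operators and closed ideal $\mathbb{K}(X)\subseteq\mathbb{L}(X)$ of compact operators (the closed linear span of the operators $z\mapsto x\langle y,z\rangle$). Let $\gamma\in\mathbb{L}(X)$ be a selfadjoint unitary (the grading; an operator is even if it commutes with $\gamma$), and let $D:\mathrm{Dom}(D)\to X$ be a selfadjoint and regular unbounded operator (densely defined, $B$-linear, symmetric, with $D\pm i$ surjective) which is odd, $D\gamma=-\gamma D$, and has compact resolvent, $(i+D)^{-1}\in\mathbb{K}(X)$. Let $H\in\mathbb{L}(X)$ be even, selfadjoint and invertible, and Lipschitz with respect to $D$: $H(\mathrm{Dom}(D))\subseteq\mathrm{Dom}(D)$ and $[D,H]$ extends to some $d(H)\in\mathbb{L}(X)$. Let $\phi:\mathbb{R}\to[0,1]$ be a localizing function: $\phi$ is even, continuous and integrable, has support in $[-1,1]$, equals $1$ on $[-\frac12,\frac12]$, satisfies $\phi(x_0)\ge\phi(x_1)$ for $0\le x_0\le x_1$, and $p\mapsto p\,\widehat\phi(p)$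 is integrable, where $\widehat\phi(p)=\frac{1}{\sqrt{2\pi}}\int_{\mathbb{R}}\phi(x)e^{-ixp}\,dx$. For $\rho>0$ put $\Phi_\rho:=\phi_\rho(D)$ with $\phi_\rho(x)=\phi(x/\rho)$ (continuous functional calculus). With $c_\phi:=\frac{2}{\sqrt{2\pi}}\int_{\mathbb R}|p\,\widehat\phi(p)|\,dp$ and $g:=\|H^{-1}\|^{-1}$, a pair $(\kappa,\rho)$ of strictly positive numbers is admissible with respect to $(H,D,\phi)$ if $$\Big(\kappa+\frac{c_\phi\|H\|}{\rho}\Big)\|d(H)\|<\min\Big\{g^2,\frac{\kappa^2\rho^2}{4}\Big\}.$$ The spectral localizer is $$L_{\kappa,\rho}(H,D,\phi):=\Phi_\rho\gamma H\Phi_\rho+\kappa\,\Phi_{2\rho}D\Phi_{2\rho}-(1-\Phi_{2\rho}^4)^{1/2}\gamma .$$ For a closed $*$-ideal $A$ in a unital $C^*$-algebra $L$ let $D(L,A)=\{(x,y)\in L\oplus L: x-y\in A\}$, let $\Delta:L\to D(L,A)$ be $\Delta(x)=(x,x)$, and let $W_n(L,A)$ be the set of selfadjoint invertible elements of $M_n(D(L,A))$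 with the norm topology. Elements $H_0\in W_n(L,A)$ and $H_1\in W_m(L,A)$ are stably homotopic if for some $k\ge n,m$ there are selfadjoint invertible $G_0\in M_{k-n}(L)$, $G_1\in M_{k-m}(L)$ such that $H_0\oplus\Delta(G_0)$ and $H_1\oplus\Delta(G_1)$ are joined by a continuous path in $W_k(L,A)$. Let $K_0^{\mathrm{inv}}(L,A)$ be the set of classes of $\bigsqcup_{n\ge1}W_n(L,A)$ under stable homotopy. **Proposition.** Let $(\kappa,\rho)$ be admissible with respect to $(H,D,\phi)$, and let $P\in\mathbb{L}(X)$ be an even projection ($P=P^*=P^2$, $P\gamma=\gamma P$) which commutes with $D$ ($PD\subseteq DP$) and satisfies $P\Phi_\rho=\Phi_\rho$ and $P\Phi_{2\rho}=P$. Then $D\Phi_{2\rho}$ and $DP$ are everywhere defined bounded adjointable operators on $X$, and the operator $$L_\kappa(H,D,P):=\gamma\big(PHP-(1-P)\big)+\kappa\,PDP:X\to X$$ is selfadjoint and invertible. The pairs $(-\gamma,L_\kappa(H,D,P))$ and $(-\gamma,L_{\kappa,\rho}(H,D,\phi))$ are selfadjoint invertible elements of $D(\mathbb{L}(X),\mathbb{K}(X))$,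 and $$\big[(-\gamma,L_\kappa(H,D,P))\big]=\big[(-\gamma,L_{\kappa,\rho}(H,D,\phi))\big]\in K_0^{\mathrm{inv}}\big(\mathbb{L}(X),\mathbb{K}(X)\big).$$ -/

import Mathlib

open scoped Topology

set_option linter.unusedSectionVars false

/-!
Hilbert C*-modules are Mathlib's `CStarModule`s that are complete.  In Mathlib the action of the
coefficient algebra is written `b • x`, with `⟪x, b • y⟫ = b * ⟪x, y⟫`.  A right Hilbert module over
a C*-algebra `A` is the same thing as a `CStarModule` over `B = Aᵐᵒᵖ`, with `op a • x` in place of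
`x a`; everything below is stated for an arbitrary C*-algebra `B` of coefficients.
-/

namespace SpectralLocalizer

noncomputable section

/-! ### Bounded adjointable operators -/

section Adjointable

variable {B X : Type*} [NonUnitalCStarAlgebra B] [PartialOrder B] [StarOrderedRing B]
  [NormedAddCommGroup X] [NormedSpace ℂ X] [SMul B X] [CStarModule B X]

theorem ext_inner {x y : X} (h : ∀ w, inner B w x = inner B w y) : x = y := by
  have h0 : inner B (x - y) (x - y) = 0 := by
    rw [CStarModule.inner_sub_right, h, sub_self]
  exact sub_eq_zero.mp (CStarModule.inner_self.mp h0)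

/-- A pair of maps `T, S : X → X` with `⟪S x, y⟫ = ⟪x, T y⟫` consists of bounded operators. -/
def ofAdjointPair [CompleteSpace X] (T S : X → X)
    (h : ∀ x y, inner B (S x) y = inner B x (T y)) : X →L[ℂ] X :=
  let T' : X →ₗ[ℂ] X :=
    { toFun := T
      map_add' := fun x y => ext_inner (B := B) fun w => by
        rw [← h, CStarModule.inner_add_right, CStarModule.inner_add_right, h, h]
      map_smul' := fun c x => ext_inner (B := B) fun w => by
        simp only [RingHom.id_apply]
        rw [← h, CStarModule.inner_smul_right_complex, CStarModule.inner_smul_right_complex, h] }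
  ⟨T', T'.continuous_of_seq_closed_graph fun u x y hu hTu => ext_inner (B := B) fun w => by
    have h1 : Filter.Tendsto (fun n => inner B w (T (u n))) Filter.atTop (𝓝 (inner B w y)) :=
      ((CStarModule.innerSL (A := B) (E := X) w).continuous.tendsto y).comp hTu
    have h2 : Filter.Tendsto (fun n => inner B (S w) (u n)) Filter.atTop
        (𝓝 (inner B (S w) x)) :=
      ((CStarModule.innerSL (A := B) (E := X) (S w)).continuous.tendsto x).comp hu
    simp only [h] at h2
    exact tendsto_nhds_unique h1 h2⟩

@[simp] theorem ofAdjointPair_apply [CompleteSpace X] (T S : X → X)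
    (h : ∀ x y, inner B (S x) y = inner B x (T y)) (x : X) : ofAdjointPair T S h x = T x := rfl

variable (B X) in
/-- The algebra `𝓛(X)` of bounded adjointable operators on `X`, with the operator norm. -/
def adjointable : Subalgebra ℂ (X →L[ℂ] X) where
  carrier := {T | ∃ S : X → X, ∀ x y, inner B (S x) y = inner B x (T y)}
  mul_mem' := by
    rintro T T' ⟨S, hS⟩ ⟨S', hS'⟩
    exact ⟨S' ∘ S, fun x y => by simp [hS, hS']⟩
  one_mem' := ⟨id, fun x y => rfl⟩
  add_mem' := by
    rintro T T' ⟨S, hS⟩ ⟨S', hS'⟩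
    exact ⟨fun x => S x + S' x, fun x y => by simp [hS, hS']⟩
  zero_mem' := ⟨0, fun x y => by simp⟩
  algebraMap_mem' r := ⟨fun x => star r • x, fun x y => by
    simp [Algebra.algebraMap_eq_smul_one]⟩

theorem inner_adj_swap {S : X → X} {T : X → X} (h : ∀ x y, inner B (S x) y = inner B x (T y))
    (x y : X) : inner B (T x) y = inner B x (S y) := by
  rw [← CStarModule.star_inner, ← h, CStarModule.star_inner]

variable [CompleteSpace X]

/-- The adjoint `T*` of `T`, characterized by `⟪T* x, y⟫ = ⟪x, T y⟫`. -/
instance : Star (adjointable B X) where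
  star T := ⟨ofAdjointPair (B := B) T.2.choose T.1 (inner_adj_swap T.2.choose_spec),
    ⟨T.1, inner_adj_swap T.2.choose_spec⟩⟩

theorem inner_star_left (T : adjointable B X) (x y : X) :
    inner B ((star T).1 x) y = inner B x (T.1 y) := T.2.choose_spec x y

theorem inner_star_right (T : adjointable B X) (x y : X) :
    inner B x ((star T).1 y) = inner B (T.1 x) y :=
  (inner_adj_swap (inner_star_left T) x y).symm

theorem adjointable_ext {S T : adjointable B X}
    (h : ∀ x y, inner B x (S.1 y) = inner B x (T.1 y)) : S = T :=
  Subtype.ext <| ContinuousLinearMap.ext fun y => ext_inner (B := B) fun x => h x y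

instance : StarRing (adjointable B X) where
  star_involutive T := adjointable_ext fun x y => by
    rw [inner_star_right, inner_star_left]
  star_mul S T := adjointable_ext fun x y => by
    change _ = inner B x ((star T).1 ((star S).1 y))
    rw [inner_star_right, inner_star_right, inner_star_right]
    rfl
  star_add S T := adjointable_ext fun x y => by
    change _ = inner B x ((star S).1 y + (star T).1 y)
    rw [CStarModule.inner_add_right, inner_star_right, inner_star_right, inner_star_right,
      ← CStarModule.inner_add_left]
    rfl

instance : StarModule ℂ (adjointable B X) where
  star_smul c T := adjointable_ext fun x y => by
    change _ = inner B x (star c • (star T).1 y)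
    rw [CStarModule.inner_smul_right_complex, inner_star_right, inner_star_right]
    change inner B (c • T.1 x) y = _
    rw [CStarModule.inner_smul_left_complex]

instance : CStarRing (adjointable B X) where
  norm_mul_self_le T := by
    have hb : ∀ x, ‖T.1 x‖ ≤ √‖star T * T‖ * ‖x‖ := fun x => by
      have h1 : ‖T.1 x‖ ^ 2 ≤ ‖star T * T‖ * ‖x‖ ^ 2 := by
        rw [CStarModule.norm_sq_eq B, ← inner_star_right]
        calc _ ≤ ‖x‖ * ‖(star T * T).1 x‖ := CStarModule.norm_inner_le X
          _ ≤ ‖x‖ * (‖star T * T‖ * ‖x‖) := by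
            gcongr
            exact (star T * T).1.le_opNorm x
          _ = _ := by ring
      calc ‖T.1 x‖ = √(‖T.1 x‖ ^ 2) := by simp
        _ ≤ √(‖star T * T‖ * ‖x‖ ^ 2) := Real.sqrt_le_sqrt h1
        _ = _ := by
          rw [Real.sqrt_mul (norm_nonneg (star T * T)), Real.sqrt_sq (norm_nonneg _)]
    have h2 : ‖T‖ ≤ √‖star T * T‖ := T.1.opNorm_le_bound (Real.sqrt_nonneg _) hb
    calc ‖T‖ * ‖T‖ ≤ √‖star T * T‖ * √‖star T * T‖ := by gcongr
      _ = _ := Real.mul_self_sqrt (norm_nonneg _)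

theorem isClosed_adjointable : IsClosed (adjointable B X : Set (X →L[ℂ] X)) := by
  refine IsSeqClosed.isClosed fun u T hu hT => ?_
  let v : ℕ → adjointable B X := fun n => ⟨u n, hu n⟩
  have hc : CauchySeq v := by
    have := hT.cauchySeq
    rw [Metric.cauchySeq_iff] at this ⊢
    exact this
  have hcs : CauchySeq fun n => (star (v n)).1 := by
    rw [Metric.cauchySeq_iff] at hc ⊢
    intro ε hε
    obtain ⟨N, hN⟩ := hc ε hε
    refine ⟨N, fun m hm n hn => ?_⟩
    have h := hN m hm n hn
    rw [dist_eq_norm] at h ⊢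
    have h' : ‖star (v m - v n)‖ < ε := (norm_star (v m - v n)).trans_lt h
    rw [star_sub] at h'
    exact h'
  obtain ⟨S, hS⟩ := cauchySeq_tendsto_of_complete hcs
  refine ⟨S, fun x y => ?_⟩
  have h1 : Filter.Tendsto (fun n => inner B ((star (v n)).1 x) y) Filter.atTop
      (𝓝 (inner B (S x) y)) :=
    (CStarModule.continuous_inner.tendsto (S x, y)).comp
      ((((ContinuousLinearMap.apply ℂ X x).continuous.tendsto S).comp hS).prodMk_nhds
        tendsto_const_nhds)
  have h2 : Filter.Tendsto (fun n => inner B x (u n y)) Filter.atTop (𝓝 (inner B x (T y))) :=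
    (CStarModule.continuous_inner.tendsto (x, T y)).comp
      (tendsto_const_nhds.prodMk_nhds
        (((ContinuousLinearMap.apply ℂ X y).continuous.tendsto T).comp hT))
  simp only [inner_star_left] at h1
  exact tendsto_nhds_unique h1 h2

/-- `𝓛(X)` is a unital C*-algebra. -/
instance : CStarAlgebra (adjointable B X) where
  toCompleteSpace := isClosed_adjointable.completeSpace_coe

end Adjointable

/-! ### Relative K-theory through selfadjoint invertibles -/

/-- A norm-closed `*`-ideal of a unital C*-algebra. -/
structure ClosedStarIdeal (L : Type*) [CStarAlgebra L] extends Submodule ℂ L where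
  mul_mem_left : ∀ (a : L) {x : L}, x ∈ carrier → a * x ∈ carrier
  mul_mem_right : ∀ (a : L) {x : L}, x ∈ carrier → x * a ∈ carrier
  star_mem : ∀ {x : L}, x ∈ carrier → star x ∈ carrier
  isClosed : IsClosed carrier

section KTheory

variable (L : Type*) [CStarAlgebra L] (A : ClosedStarIdeal L)

/-- The C*-algebra `D(L, A) = {(x, y) ∈ L ⊕ L | x - y ∈ A}`. -/
def doubleAlg : StarSubalgebra ℂ (L × L) where
  carrier := {p | p.1 - p.2 ∈ A.toSubmodule}
  mul_mem' := by
    rintro p q hp hq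
    have h : (p * q).1 - (p * q).2 = p.1 * (q.1 - q.2) + (p.1 - p.2) * q.2 := by
      simp only [Prod.fst_mul, Prod.snd_mul]
      noncomm_ring
    change (p * q).1 - (p * q).2 ∈ A.toSubmodule
    rw [h]
    exact add_mem (A.mul_mem_left _ hq) (A.mul_mem_right _ hp)
  add_mem' := by
    rintro p q hp hq
    have h : (p + q).1 - (p + q).2 = (p.1 - p.2) + (q.1 - q.2) := by
      simp only [Prod.fst_add, Prod.snd_add]
      abel
    change (p + q).1 - (p + q).2 ∈ A.toSubmodule
    rw [h]
    exact add_mem hp hq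
  algebraMap_mem' r := by simp
  star_mem' := by
    rintro p hp
    have h : (star p).1 - (star p).2 = star (p.1 - p.2) := by simp
    change (star p).1 - (star p).2 ∈ A.toSubmodule
    rw [h]
    exact A.star_mem hp

instance : IsClosed (doubleAlg L A : Set (L × L)) :=
  A.isClosed.preimage (continuous_fst.sub continuous_snd)

instance : PartialOrder (doubleAlg L A) := CStarAlgebra.spectralOrder _

instance : StarOrderedRing (doubleAlg L A) := CStarAlgebra.spectralOrderedRing _

/-- The diagonal inclusion `Δ : L → D(L, A)`, `Δ x = (x, x)`. -/
def diag : L →⋆ₐ[ℂ] doubleAlg L A where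
  toFun x := ⟨(x, x), by change x - x ∈ A.toSubmodule; simp⟩
  map_one' := rfl
  map_mul' _ _ := rfl
  map_zero' := rfl
  map_add' _ _ := rfl
  commutes' _ := rfl
  map_star' _ := rfl

/-- The selfadjoint invertible elements of the `n × n`-matrices over a `*`-algebra `R`. -/
abbrev SaInv (R : Type*) [Ring R] [StarRing R] (n : ℕ) : Type _ :=
  {M : CStarMatrix (Fin n) (Fin n) R // IsSelfAdjoint M ∧ IsUnit M}

/-- `W_n(L, A)`: the selfadjoint invertible elements of `M_n(D(L, A))`, with the topology given by
the C*-norm of `M_n(D(L, A))`. -/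
abbrev W (n : ℕ) : Type _ := SaInv (doubleAlg L A) n

variable {L A}

/-- Entrywise application of a unital `*`-homomorphism to selfadjoint invertible matrices. -/
def SaInv.map {R S : Type*} [Ring R] [StarRing R] [Algebra ℂ R] [Ring S] [StarRing S]
    [Algebra ℂ S] (f : R →⋆ₐ[ℂ] S) {n : ℕ} (M : SaInv R n) : SaInv S n :=
  ⟨M.1.map f, by
    ext i j
    have h := congrArg (fun N => f (N i j)) M.2.1.star_eq
    simpa [CStarMatrix.star_apply, map_star] using h, by
    have h := M.2.2.map (f : R →+* S).mapMatrix
    exact h⟩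

/-- The block sum `M ⊕ N` of matrices of sizes `n` and `p`, as a matrix of size `k = n + p`. -/
def blockSum {R : Type*} [Ring R] {n p k : ℕ} (h : n + p = k)
    (M : Matrix (Fin n) (Fin n) R) (N : Matrix (Fin p) (Fin p) R) : Matrix (Fin k) (Fin k) R :=
  Matrix.reindex (finSumFinEquiv.trans (finCongr h)) (finSumFinEquiv.trans (finCongr h))
    (Matrix.fromBlocks M 0 0 N)

theorem blockSum_star {R : Type*} [Ring R] [StarRing R] {n p k : ℕ} (h : n + p = k)
    (M : Matrix (Fin n) (Fin n) R) (N : Matrix (Fin p) (Fin p) R) :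
    (blockSum h M N).conjTranspose = blockSum h M.conjTranspose N.conjTranspose := by
  rw [blockSum, Matrix.conjTranspose_reindex, Matrix.fromBlocks_conjTranspose]
  simp [blockSum]

theorem blockSum_mul {R : Type*} [Ring R] {n p k : ℕ} (h : n + p = k)
    (M M' : Matrix (Fin n) (Fin n) R) (N N' : Matrix (Fin p) (Fin p) R) :
    blockSum h M N * blockSum h M' N' = blockSum h (M * M') (N * N') := by
  simp only [blockSum, Matrix.reindex_apply, Matrix.submatrix_mul_equiv,
    Matrix.fromBlocks_multiply]
  simp

theorem blockSum_one {R : Type*} [Ring R] {n p k : ℕ} (h : n + p = k) :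
    blockSum h (1 : Matrix (Fin n) (Fin n) R) (1 : Matrix (Fin p) (Fin p) R) = 1 := by
  simp only [blockSum, Matrix.reindex_apply, Matrix.fromBlocks_one, Matrix.submatrix_one_equiv]

/-- The block sum `M ⊕ N` of selfadjoint invertible matrices. -/
def SaInv.sum {R : Type*} [Ring R] [StarRing R] {n p k : ℕ} (h : n + p = k)
    (M : SaInv R n) (N : SaInv R p) : SaInv R k :=
  ⟨CStarMatrix.ofMatrix
      (blockSum h (CStarMatrix.ofMatrix.symm M.1) (CStarMatrix.ofMatrix.symm N.1)), by
    have hM : (CStarMatrix.ofMatrix.symm M.1).conjTranspose = CStarMatrix.ofMatrix.symm M.1 :=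
      M.2.1.star_eq
    have hN : (CStarMatrix.ofMatrix.symm N.1).conjTranspose = CStarMatrix.ofMatrix.symm N.1 :=
      N.2.1.star_eq
    have e := blockSum_star h (CStarMatrix.ofMatrix.symm M.1) (CStarMatrix.ofMatrix.symm N.1)
    rw [hM, hN] at e
    exact e, by
    obtain ⟨v, huv, hvu⟩ := isUnit_iff_exists.mp M.2.2
    obtain ⟨v', huv', hvu'⟩ := isUnit_iff_exists.mp N.2.2
    refine isUnit_iff_exists.mpr ⟨CStarMatrix.ofMatrix
      (blockSum h (CStarMatrix.ofMatrix.symm v) (CStarMatrix.ofMatrix.symm v')), ?_, ?_⟩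
    · exact (blockSum_mul h _ _ _ _).trans
        ((congrArg₂ (blockSum h) huv huv').trans (blockSum_one h))
    · exact (blockSum_mul h _ _ _ _).trans
        ((congrArg₂ (blockSum h) hvu hvu').trans (blockSum_one h))⟩

/-- Stable homotopy: `H₀ ∈ W_n` and `H₁ ∈ W_m` are stably homotopic if, for some `k ≥ n, m` and
selfadjoint invertible `G₀ ∈ M_{k-n}(L)`, `G₁ ∈ M_{k-m}(L)`, the elements `H₀ ⊕ Δ(G₀)` and
`H₁ ⊕ Δ(G₁)` are joined by a continuous path in `W_k`. -/
def StablyHomotopic (a b : Σ n : ℕ+, W L A n) : Prop :=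
  ∃ (k p q : ℕ) (hp : (a.1 : ℕ) + p = k) (hq : (b.1 : ℕ) + q = k) (G₀ : SaInv L p)
    (G₁ : SaInv L q),
    Joined (X := W L A k) (SaInv.sum hp a.2 (G₀.map (diag L A)))
      (SaInv.sum hq b.2 (G₁.map (diag L A)))

variable (L A) in
/-- `K₀^inv(L, A)`: the quotient of the disjoint union of the `W_n(L, A)`, `n ≥ 1`, by stable
homotopy. -/
def K0inv : Type _ := Quot (StablyHomotopic (L := L) (A := A))

variable (A) in
/-- The pair `(x, y)` is a selfadjoint invertible element of `D(L, A)`. -/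
structure IsCycle (x y : L) : Prop where
  mem : (x, y) ∈ doubleAlg L A
  isSelfAdjoint : IsSelfAdjoint (⟨(x, y), mem⟩ : doubleAlg L A)
  isUnit : IsUnit (⟨(x, y), mem⟩ : doubleAlg L A)

/-- A selfadjoint invertible element of `R` as a `1 × 1`-matrix. -/
def SaInv.single {R : Type*} [Ring R] [StarRing R] (x : R) (hx : IsSelfAdjoint x)
    (hu : IsUnit x) : SaInv R 1 :=
  ⟨CStarMatrix.ofMatrix fun _ _ => x, by
    ext i j
    exact hx.star_eq, by
    obtain ⟨y, hxy, hyx⟩ := isUnit_iff_exists.mp hu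
    refine isUnit_iff_exists.mpr ⟨CStarMatrix.ofMatrix fun _ _ => y, ?_, ?_⟩ <;> ext i j <;>
      rw [CStarMatrix.mul_apply, CStarMatrix.one_apply, if_pos (Subsingleton.elim i j),
        Fin.sum_univ_one]
    · exact hxy
    · exact hyx⟩

/-- The class `[(x, y)] ∈ K₀^inv(L, A)` of a selfadjoint invertible element `(x, y) ∈ D(L, A)`. -/
def IsCycle.cls {x y : L} (h : IsCycle A x y) : K0inv L A :=
  Quot.mk _ ⟨1, SaInv.single ⟨(x, y), h.mem⟩ h.isSelfAdjoint h.isUnit⟩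

end KTheory

/-! ### Unbounded Kasparov modules -/

variable {B X : Type*} [NonUnitalCStarAlgebra B] [PartialOrder B] [StarOrderedRing B]
  [NormedAddCommGroup X] [NormedSpace ℂ X] [SMul B X] [CStarModule B X]

variable (B) in
/-- A C*-algebra is `σ`-unital if it has a countable (sequential) increasing approximate unit. -/
def IsSigmaUnital : Prop :=
  ∃ u : ℕ → B, Monotone u ∧ (Filter.map u Filter.atTop).IsIncreasingApproximateUnit

variable (B X) in
/-- `X` is countably generated: for a countable set `S`, the linear combinations of the elements
`b • s` with `b ∈ B` and `s ∈ S` are dense. -/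
def IsCountablyGenerated : Prop :=
  ∃ S : Set X, S.Countable ∧
    Dense (Submodule.span ℂ {x : X | ∃ b : B, ∃ s ∈ S, x = b • s} : Set X)

variable (B X) in
/-- A selfadjoint and regular unbounded operator `D : Dom(D) → X`: it is `B`-linear, densely
defined, symmetric, and `D + i` and `D - i` are surjective. -/
structure SaRegular where
  op : X →ₗ.[ℂ] X
  smul_mem : ∀ (b : B) (x : op.domain), b • (x : X) ∈ op.domain
  map_smul : ∀ (b : B) (x : op.domain), op ⟨b • (x : X), smul_mem b x⟩ = b • op x
  dense : Dense (op.domain : Set X)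
  symm : ∀ x y : op.domain, inner B (op x) (y : X) = inner B (x : X) (op y)
  surj_add : ∀ y : X, ∃ x : op.domain, op x + Complex.I • (x : X) = y
  surj_sub : ∀ y : X, ∃ x : op.domain, op x - Complex.I • (x : X) = y

variable [CompleteSpace X]

/-- The rank one operator `z ↦ x ⟪y, z⟫`. -/
def rankOne (x y : X) : adjointable B X :=
  have h : ∀ (x y v w : X), inner B (inner B x v • y) w = inner B v (inner B y w • x) :=
    fun x y v w => by simp
  ⟨ofAdjointPair (B := B) (fun z => inner B y z • x) (fun z => inner B x z • y) (h x y),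
    ⟨fun z => inner B x z • y, h x y⟩⟩

theorem mul_rankOne (T : adjointable B X) (x y : X) :
    T * rankOne (B := B) x y = rankOne (T.1 x) y := adjointable_ext fun v w => by
  change inner B v (T.1 (inner B y w • x)) = inner B v (inner B y w • T.1 x)
  rw [← inner_star_left]
  simp [inner_star_left]

theorem star_rankOne (x y : X) : star (rankOne (B := B) x y) = rankOne y x :=
  adjointable_ext fun v w => by
    rw [inner_star_right]
    change inner B (inner B y v • x) w = inner B v (inner B x w • y)
    simp

variable (B X) in
/-- The closed `*`-ideal `𝓚(X)` of compact operators: the closed linear span of the rank one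
operators. -/
def compacts : ClosedStarIdeal (adjointable B X) :=
  let V : Submodule ℂ (adjointable B X) :=
    Submodule.span ℂ {T | ∃ x y : X, T = rankOne x y}
  have hstar : ∀ {T : adjointable B X}, T ∈ V.topologicalClosure →
      star T ∈ V.topologicalClosure := fun {T} hT => by
    refine map_mem_closure (t := (V : Set (adjointable B X))) continuous_star hT fun S hS => ?_
    induction hS using Submodule.span_induction with
    | mem S hS =>
      obtain ⟨x, y, rfl⟩ := hS
      rw [star_rankOne]
      exact Submodule.subset_span ⟨y, x, rfl⟩
    | zero => simp
    | add S S' _ _ h h' => rw [star_add]; exact add_mem h h'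
    | smul c S _ h => rw [star_smul]; exact V.smul_mem _ h
  have hleft : ∀ (S : adjointable B X) {T : adjointable B X}, T ∈ V.topologicalClosure →
      S * T ∈ V.topologicalClosure := fun S {T} hT => by
    refine map_mem_closure (t := (V : Set (adjointable B X))) (continuous_const_mul S) hT
      fun R hR => ?_
    induction hR using Submodule.span_induction with
    | mem R hR =>
      obtain ⟨x, y, rfl⟩ := hR
      rw [mul_rankOne]
      exact Submodule.subset_span ⟨_, y, rfl⟩
    | zero => simp
    | add R R' _ _ h h' => rw [mul_add]; exact add_mem h h'
    | smul c R _ h => rw [mul_smul_comm]; exact V.smul_mem _ h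
  { V.topologicalClosure with
    mul_mem_left := hleft
    mul_mem_right := fun S T hT => by
      have h := hstar (hleft (star S) (hstar hT))
      rwa [star_mul, star_star, star_star] at h
    star_mem := hstar
    isClosed := V.isClosed_topologicalClosure }

namespace SaRegular

variable (D : SaRegular B X)

theorem exists_resolvent : ∃ R : adjointable B X, ∀ y : X, ∃ h : R.1 y ∈ D.op.domain,
    D.op ⟨R.1 y, h⟩ + Complex.I • R.1 y = y := by
  choose R hR using D.surj_add
  choose S hS using D.surj_sub
  have h : ∀ x y, inner B (S x : X) y = inner B x (R y : X) := fun x y => by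
    conv_lhs => rw [← hR y]
    conv_rhs => rw [← hS x]
    simp [D.symm]
  exact ⟨⟨ofAdjointPair (B := B) (fun y => (R y : X)) (fun y => (S y : X)) h,
    ⟨fun y => (S y : X), h⟩⟩, fun y => ⟨(R y).2, hR y⟩⟩

/-- The bounded adjointable operator `(D + i)⁻¹`. -/
def resolvent : adjointable B X := D.exists_resolvent.choose

theorem resolvent_mem (y : X) : D.resolvent.1 y ∈ D.op.domain :=
  (D.exists_resolvent.choose_spec y).1

theorem resolvent_spec (y : X) :
    D.op ⟨D.resolvent.1 y, D.resolvent_mem y⟩ + Complex.I • D.resolvent.1 y = y :=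
  (D.exists_resolvent.choose_spec y).2

/-- The Cayley transform `C_D = (D - i)(D + i)⁻¹ = 1 - 2i (D + i)⁻¹`. -/
def cayley : adjointable B X := 1 - (2 * Complex.I) • D.resolvent

theorem cayley_apply (y : X) : D.cayley.1 y =
    D.op ⟨D.resolvent.1 y, D.resolvent_mem y⟩ - Complex.I • D.resolvent.1 y := by
  change y - (2 * Complex.I) • D.resolvent.1 y = _
  nth_rw 1 [← D.resolvent_spec y]
  rw [mul_smul, two_smul]
  abel

/-- The functional calculus `f(D)`, for continuous `f : ℝ → ℝ` vanishing at infinity: the function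
`f ∘ c⁻¹`, where `c⁻¹(z) = -i (z + 1)(z - 1)⁻¹`, extended by `0` at `z = 1`, is applied to the
unitary `C_D = c(D)`, where `c(x) = (x - i)(x + i)⁻¹`. -/
def calc₀ (f : ℝ → ℝ) : adjointable B X :=
  cfc (fun z : ℂ => if z = 1 then (0 : ℂ)
    else ((f (-Complex.I * (z + 1) / (z - 1)).re : ℝ) : ℂ)) D.cayley

/-- `IsComp T S` says that `T` maps `X` into the domain of `D` and that `S = D T`. -/
def IsComp (T S : adjointable B X) : Prop :=
  ∀ x : X, ∃ h : T.1 x ∈ D.op.domain, D.op ⟨T.1 x, h⟩ = S.1 x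

open Classical in
/-- The composite `D T`, for a bounded adjointable operator `T` with image in the domain of `D`
(and the value `0` if there is no such bounded adjointable composite). -/
def comp (T : adjointable B X) : adjointable B X :=
  if h : ∃ S, D.IsComp T S then h.choose else 0

theorem comp_eq {T S : adjointable B X} (h : D.IsComp T S) : D.comp T = S := by
  have h' : ∃ S, D.IsComp T S := ⟨S, h⟩
  rw [comp, dif_pos h']
  refine Subtype.ext <| ContinuousLinearMap.ext fun x => ?_
  obtain ⟨_, h1⟩ := h'.choose_spec x
  obtain ⟨_, h2⟩ := h x
  rw [← h1, ← h2]

/-- `δ` is a bounded adjointable extension of the commutator `[D, T] : Dom(D) → X`, where `T`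
preserves the domain of `D`. -/
def IsDeriv (T δ : adjointable B X) : Prop :=
  ∀ x : D.op.domain, ∃ h : T.1 x ∈ D.op.domain, D.op ⟨T.1 x, h⟩ - T.1 (D.op x) = δ.1 x

/-- `T` is a Lipschitz operator with respect to `D`. -/
def IsLipschitz (T : adjointable B X) : Prop := ∃ δ, D.IsDeriv T δ

/-- The bounded adjointable extension `d(T)` of the commutator `[D, T]`. -/
def IsLipschitz.d {D : SaRegular B X} {T : adjointable B X} (h : D.IsLipschitz T) :
    adjointable B X := h.choose

/-- `T` commutes with `D`: `T D ⊆ D T`. -/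
def CommutesWith (T : adjointable B X) : Prop :=
  ∀ x : D.op.domain, ∃ h : T.1 x ∈ D.op.domain, D.op ⟨T.1 x, h⟩ = T.1 (D.op x)

end SaRegular

variable (B X) in
/-- An even unbounded Kasparov module `(X, D)` over `B`: the Hilbert C*-module `X` is countably
generated and graded by a selfadjoint unitary `γ`, and `D` is an odd selfadjoint and regular
unbounded operator with compact resolvent. -/
structure KasparovModule where
  countablyGenerated : IsCountablyGenerated B X
  γ : adjointable B X
  γ_isSelfAdjoint : IsSelfAdjoint γ
  γ_sq : γ * γ = 1
  D : SaRegular B X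
  odd : ∀ x : D.op.domain, ∃ h : γ.1 x ∈ D.op.domain, D.op ⟨γ.1 x, h⟩ = -γ.1 (D.op x)
  resolvent_compact : D.resolvent ∈ (compacts B X).toSubmodule

/-! ### Spectral localizers -/

/-- The Fourier transform `(2π)^{-1/2} ∫ f(x) e^{-ixp} dx`. -/
def fourier (f : ℝ → ℝ) (p : ℝ) : ℂ :=
  ((1 / √(2 * Real.pi) : ℝ) : ℂ) * ∫ x : ℝ, (f x : ℂ) * Complex.exp (-Complex.I * x * p)

/-- Localizing functions `φ : ℝ → [0, 1]`. -/
structure IsLocalizing (φ : ℝ → ℝ) : Prop where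
  mem_Icc : ∀ x, φ x ∈ Set.Icc (0 : ℝ) 1
  even : ∀ x, φ (-x) = φ x
  continuous : Continuous φ
  integrable : MeasureTheory.Integrable φ
  support : tsupport φ ⊆ Set.Icc (-1) 1
  eq_one : ∀ x ∈ Set.Icc (-1 / 2 : ℝ) (1 / 2), φ x = 1
  antitone : ∀ x₀ x₁, 0 ≤ x₀ → x₀ ≤ x₁ → φ x₁ ≤ φ x₀
  integrable_fourier : MeasureTheory.Integrable fun p : ℝ => (p : ℂ) * fourier φ p

/-- The constant `c_φ = 2 (2π)^{-1/2} ‖p φ̂(p)‖₁`. -/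
def localConst (φ : ℝ → ℝ) : ℝ :=
  2 * (∫ p : ℝ, ‖(p : ℂ) * fourier φ p‖) / √(2 * Real.pi)

/-- The operator `Φ_ρ = φ_ρ(D)`, where `φ_ρ(x) = φ(x / ρ)`. -/
def SaRegular.Phi (D : SaRegular B X) (φ : ℝ → ℝ) (ρ : ℝ) : adjointable B X :=
  D.calc₀ fun x => φ (x / ρ)

/-- Admissibility of `(κ, ρ)` with respect to `(H, D, φ)`: both numbers are positive and
`(κ + c_φ ‖H‖ / ρ) ‖d(H)‖ < min {g², κ² ρ² / 4}`, where `g = ‖H⁻¹‖⁻¹` is the gap of the invertible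
operator `H`. -/
def IsAdmissible {D : SaRegular B X} {H : adjointable B X} (hH : D.IsLipschitz H) (φ : ℝ → ℝ)
    (κ ρ : ℝ) : Prop :=
  0 < κ ∧ 0 < ρ ∧
    (κ + localConst φ * ‖H‖ / ρ) * ‖hH.d‖ < min (‖Ring.inverse H‖⁻¹ ^ 2) (κ ^ 2 * ρ ^ 2 / 4)

namespace KasparovModule

variable (M : KasparovModule B X)

/-- The spectral localizer
`L_{κ,ρ}(H, D, φ) = Φ_ρ γ H Φ_ρ + κ Φ_{2ρ} D Φ_{2ρ} - (1 - Φ_{2ρ}⁴)^{1/2} γ`. -/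
def localizer (H : adjointable B X) (φ : ℝ → ℝ) (κ ρ : ℝ) : adjointable B X :=
  M.D.Phi φ ρ * M.γ * H * M.D.Phi φ ρ
    + (κ : ℂ) • (M.D.Phi φ (2 * ρ) * M.D.comp (M.D.Phi φ (2 * ρ)))
    - cfc Real.sqrt (1 - M.D.Phi φ (2 * ρ) ^ 4) * M.γ

/-- The operator `L_κ(H, D, P) = γ (P H P - (1 - P)) + κ P D P`. -/
def projLocalizer (H P : adjointable B X) (κ : ℝ) : adjointable B X :=
  M.γ * (P * H * P - (1 - P)) + (κ : ℂ) • (P * M.D.comp P)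

end KasparovModule

end

end SpectralLocalizer

namespace SpectralLocalizer

noncomputable section

/-! ### Commutators with functions of a bounded selfadjoint element -/

section BoundedCommutator

open MeasureTheory

open scoped FourierTransform

variable {A : Type*} [CStarAlgebra A]

/-! Put `G = (1-t) Φ_ρ + t P` and `F = (1-t) Φ_{2ρ} + t P`. The operators `L_t = G γ H G + κ F D F -
(1 - F⁴)^{1/2} γ` run from the spectral localizer at `t = 0` to `L_κ(H, D, P)` at `t = 1`, where `F`
is the projection `P`. Both `G` and `F` are compact (`P = P Φ_{2ρ}` is), hence so is `L_t + γ`. Once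
every `L_t` is invertible, `(-γ, L_t)` is a path of cycles and the classes agree without
stabilization.

In `L_t` the operator `D` occurs only next to `Φ_{2ρ}` and `P`, so it can be replaced by the bounded
`K = D Φ_{4ρ}`, and the problem moves into a C*-algebra. Since `K` is odd and `F G = G`, the
unwanted cross terms cancel (`localizer_mul_self`): `L_t² = G H G² H G + κ G γ [H, K] G + κ² F⁴ K² +
1 - F⁴`. Now `G² ≥ Φ_ρ²`, moving `Φ_ρ` across `H` costs at most `2 ‖[Φ_ρ, H]‖ ‖H‖`, `H² ≥ g²`, and
`P [K, H] P = P d(H) P` (`SaRegular.compression_commutator`). So `L_t² ≥ g² G Φ_ρ² G - δ G² + κ² F⁴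
K² + 1 - F⁴`, with `δ` the left side of the admissibility condition. The terms on the right commute,
so they are bounded below pointwise, by characters (`IsCutoff.bounds`): where `Φ_ρ = 1` the value is
at least `g² - δ`; elsewhere `|D| ≥ ρ/2`, and the value is at least `κ² ρ²/4 - δ` on `P` and `min
{1, κ² ρ²/4}` off `P`. Admissibility makes these positive (`IsCutoff.isUnit_localizerPath`).

The bound `‖[Φ_ρ, H]‖ ≤ c_φ ‖d(H)‖ / (2ρ)` comes from Fourier inversion when `D` is bounded
(`norm_commutator_cfc_le`). It passes to unbounded `D` through the bounded approximations `c² D (D²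
+ c²)⁻¹`, whose commutators with `H` are uniformly bounded by `‖d(H)‖`
(`SaRegular.norm_commutator_funCalc_le`). -/

theorem norm_exp_I_smul_le {T : A} (hT : IsSelfAdjoint T) (t : ℝ) :
    ‖NormedSpace.exp (t • (Complex.I • T))‖ ≤ 1 := by
  have h := (selfAdjoint.expUnitary ⟨t • T, (IsSelfAdjoint.all t).smul hT⟩).2
  rw [selfAdjoint.expUnitary_coe] at h
  change NormedSpace.exp (Complex.I • (t • T)) ∈ _ at h
  rw [smul_comm] at h
  rcases subsingleton_or_nontrivial A with hA | hA
  · rw [Subsingleton.elim (NormedSpace.exp _) (0 : A)]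
    simp
  · exact (CStarRing.norm_of_mem_unitary h).le

/-- With `X = iT`, the derivative of `s ↦ e^{sX} a e^{-sX}` is `e^{sX} [X, a] e^{-sX}`, of norm at
most `‖[T, a]‖` because the exponentials are contractions. The mean value inequality then bounds
`e^{pX} a e^{-pX} - a`. -/
theorem norm_commutator_exp_le {T : A} (hT : IsSelfAdjoint T) (a : A) (p : ℝ) :
    ‖NormedSpace.exp (p • (Complex.I • T)) * a - a * NormedSpace.exp (p • (Complex.I • T))‖
      ≤ |p| * ‖T * a - a * T‖ := by
  set X : A := Complex.I • T with hX
  -- The mean value inequality is applied on `[0, q]`; the sign `ε` covers negative parameters.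
  have key : ∀ q : ℝ, 0 ≤ q → ∀ ε : ℝ, |ε| = 1 →
      ‖NormedSpace.exp ((ε * q) • X) * a * NormedSpace.exp ((-(ε * q)) • X) - a‖
        ≤ q * ‖T * a - a * T‖ := by
    intro q hq ε hε
    let f : ℝ → A := fun s => NormedSpace.exp (s • (ε • X)) * a * NormedSpace.exp (s • (-(ε • X)))
    have hf : ∀ s, HasDerivAt f (NormedSpace.exp (s • (ε • X)) * (ε • X * a - a * (ε • X)) *
        NormedSpace.exp (s • (-(ε • X)))) s := fun s => by
      have h := ((hasDerivAt_exp_smul_const (ε • X) s).mul_const a).mul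
        (hasDerivAt_exp_smul_const' (-(ε • X)) s)
      refine h.congr_deriv ?_
      rw [mul_sub, sub_mul]
      simp only [mul_assoc, neg_mul, mul_neg, sub_eq_add_neg]
    have hb : ∀ s : ℝ, ‖NormedSpace.exp (s • (ε • X)) * (ε • X * a - a * (ε • X)) *
        NormedSpace.exp (s • (-(ε • X)))‖ ≤ ‖T * a - a * T‖ := fun s => by
      have e1 : ‖NormedSpace.exp (s • (ε • X))‖ ≤ 1 := by
        rw [smul_smul]; exact norm_exp_I_smul_le hT _
      have e2 : ‖NormedSpace.exp (s • (-(ε • X)))‖ ≤ 1 := by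
        rw [← neg_smul, smul_smul]; exact norm_exp_I_smul_le hT _
      have e3 : ‖ε • X * a - a * (ε • X)‖ = ‖T * a - a * T‖ := by
        rw [hX, smul_mul_assoc, mul_smul_comm, smul_mul_assoc, mul_smul_comm, ← smul_sub,
          ← smul_sub, norm_smul, norm_smul, Real.norm_eq_abs, hε]
        simp
      calc _ ≤ ‖NormedSpace.exp (s • (ε • X))‖ * ‖ε • X * a - a * (ε • X)‖ *
            ‖NormedSpace.exp (s • (-(ε • X)))‖ := norm_mul₃_le
        _ ≤ 1 * ‖T * a - a * T‖ * 1 := by rw [e3]; gcongr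
        _ = _ := by ring
    have h := (convex_Icc (0 : ℝ) q).norm_image_sub_le_of_norm_hasDerivWithin_le
      (fun s _ => (hf s).hasDerivWithinAt) (fun s _ => hb s)
      (Set.left_mem_Icc.2 hq) (Set.right_mem_Icc.2 hq)
    simp only [f, zero_smul, NormedSpace.exp_zero, one_mul, mul_one, sub_zero] at h
    rw [Real.norm_of_nonneg hq, mul_comm] at h
    rwa [smul_neg, smul_smul, ← neg_smul, mul_comm q ε] at h
  have h0 : ∀ p : ℝ, ‖NormedSpace.exp (p • X) * a * NormedSpace.exp ((-p) • X) - a‖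
        ≤ |p| * ‖T * a - a * T‖ := fun p => by
    rcases le_total 0 p with hp | hp
    · have := key p hp 1 (by simp)
      rw [abs_of_nonneg hp]
      simpa using this
    · have := key (-p) (by linarith) (-1) (by simp)
      rw [abs_of_nonpos hp]
      simpa using this
  have e : NormedSpace.exp (p • X) * a - a * NormedSpace.exp (p • X) =
      (NormedSpace.exp (p • X) * a * NormedSpace.exp ((-p) • X) - a) *
        NormedSpace.exp (p • X) := by
    have h1 : NormedSpace.exp ((-p) • X) * NormedSpace.exp (p • X) = 1 := by
      let +nondep : NormedAlgebra ℚ A := .restrictScalars ℚ ℂ A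
      rw [← NormedSpace.exp_add_of_commute]
      · simp
      · exact ((Commute.refl X).smul_left _).smul_right _
    rw [sub_mul, mul_assoc _ (NormedSpace.exp ((-p) • X)), h1, mul_one]
  rw [e]
  calc _ ≤ _ * ‖NormedSpace.exp (p • X)‖ := norm_mul_le _ _
    _ ≤ (|p| * ‖T * a - a * T‖) * 1 := by gcongr; exacts [h0 p, norm_exp_I_smul_le hT p]
    _ = _ := mul_one _

/-! ### Fourier inversion in the normalization `(2π)^{-1/2}` -/

theorem fourier_eq (f : ℝ → ℝ) (p : ℝ) :
    fourier f p = ((1 / √(2 * Real.pi) : ℝ) : ℂ) *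
      𝓕 (fun x : ℝ => (f x : ℂ)) ((2 * Real.pi)⁻¹ * p) := by
  rw [fourier, Real.fourier_real_eq_integral_exp_smul]
  congr 2
  ext x
  rw [smul_eq_mul, mul_comm]
  congr 2
  have : (Real.pi : ℂ) ≠ 0 := by exact_mod_cast Real.pi_ne_zero
  push_cast
  field_simp

theorem continuous_fourier_of_integrable {f : ℝ → ℝ} (hf : Integrable f) :
    Continuous (fourier f) := by
  have h : Continuous (𝓕 (fun x : ℝ => (f x : ℂ))) :=
    VectorFourier.fourierIntegral_continuous Real.continuous_fourierChar
      (by fun_prop) hf.ofReal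
  have e : fourier f = fun p => ((1 / √(2 * Real.pi) : ℝ) : ℂ) *
      𝓕 (fun x : ℝ => (f x : ℂ)) ((2 * Real.pi)⁻¹ * p) := funext (fourier_eq f)
  rw [e]
  exact continuous_const.mul (h.comp (continuous_const.mul continuous_id))

/-- On `[-1, 1]` the transform is continuous, and outside it is dominated by `|p f̂(p)|`. -/
theorem integrable_fourier_of_integrable_mul {f : ℝ → ℝ} (hf : Integrable f)
    (h : Integrable fun p : ℝ => (p : ℂ) * fourier f p) : Integrable (fourier f) := by
  have hc := continuous_fourier_of_integrable hf
  have h1 : Integrable ((Set.Icc (-1 : ℝ) 1).indicator (fourier f)) :=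
    (hc.continuousOn.integrableOn_compact isCompact_Icc).integrable_indicator measurableSet_Icc
  refine (h1.norm.add h.norm).mono' hc.aestronglyMeasurable (.of_forall fun p => ?_)
  simp only [Pi.add_apply, norm_mul, Complex.norm_real, Real.norm_eq_abs]
  by_cases hp : p ∈ Set.Icc (-1 : ℝ) 1
  · rw [Set.indicator_of_mem hp]
    have := norm_nonneg (fourier f p)
    have := abs_nonneg p
    nlinarith
  · rw [Set.indicator_of_notMem hp]
    have hp' : 1 ≤ |p| := by
      by_contra hlt
      exact hp (abs_le.1 (not_le.1 hlt).le)
    have := norm_nonneg (fourier f p)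
    simp only [norm_zero]
    nlinarith

theorem fourier_inversion {f : ℝ → ℝ} (hc : Continuous f) (hf : Integrable f)
    (h : Integrable (fourier f)) (x : ℝ) :
    (f x : ℂ) = ((1 / √(2 * Real.pi) : ℝ) : ℂ) *
      ∫ p : ℝ, fourier f p * Complex.exp (Complex.I * p * x) := by
  have hpi : (0 : ℝ) < 2 * Real.pi := by positivity
  have hsq : (√(2 * Real.pi) : ℂ) * √(2 * Real.pi) = 2 * Real.pi := by
    exact_mod_cast Real.mul_self_sqrt hpi.le
  have hs0 : (√(2 * Real.pi) : ℂ) ≠ 0 := by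
    exact_mod_cast (Real.sqrt_pos.2 hpi).ne'
  have hpi0 : (2 * Real.pi : ℂ) ≠ 0 := by exact_mod_cast hpi.ne'
  have hF : ∀ w, 𝓕 (fun x : ℝ => (f x : ℂ)) w = √(2 * Real.pi) * fourier f (2 * Real.pi * w) :=
    fun w => by
    rw [fourier_eq, inv_mul_cancel_left₀ hpi.ne', ← mul_assoc]
    push_cast
    rw [mul_one_div_cancel hs0, one_mul]
  have hFi : Integrable (𝓕 (fun x : ℝ => (f x : ℂ))) := by
    rw [show 𝓕 (fun x : ℝ => (f x : ℂ)) = _ from funext hF]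
    exact (h.comp_mul_left' hpi.ne').const_mul _
  have hinv := congrFun (Continuous.fourierInv_fourier_eq
    (Complex.continuous_ofReal.comp hc) hf.ofReal hFi) x
  change _ = (f x : ℂ) at hinv
  rw [← hinv, Real.fourierInv_eq']
  change (∫ v : ℝ, Complex.exp _ • 𝓕 (fun x : ℝ => (f x : ℂ)) v) = _
  have e : ∀ v : ℝ, Complex.exp (((2 * Real.pi * inner ℝ v x : ℝ) : ℂ) * Complex.I) •
      𝓕 (fun x : ℝ => (f x : ℂ)) v = √(2 * Real.pi) * (fun p : ℝ => fourier f p *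
        Complex.exp (Complex.I * p * x)) (2 * Real.pi * v) := fun v => by
    rw [hF, smul_eq_mul]
    simp only [RCLike.inner_apply, conj_trivial]
    have : (((2 * Real.pi * (x * v) : ℝ) : ℂ) * Complex.I) =
        Complex.I * ((2 * Real.pi * v : ℝ) : ℂ) * x := by push_cast; ring
    rw [this]
    ring
  simp_rw [e]
  rw [integral_const_mul, Measure.integral_comp_mul_left
    (fun p : ℝ => fourier f p * Complex.exp (Complex.I * p * x)), abs_of_pos (inv_pos.2 hpi),
    Complex.real_smul, ← mul_assoc]
  congr 1
  push_cast
  rw [eq_div_iff hs0]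
  field_simp
  rw [sq, hsq]

/-- For a selfadjoint element `T` and a function `f` on the real line with
`p ↦ p f̂(p)` integrable, the commutator of `f(T / ρ)` with `a` has norm at most
`(2π)^{-1/2} ‖p f̂(p)‖₁ ‖[T, a]‖ / ρ`. -/
theorem norm_commutator_cfc_le {f : ℝ → ℝ} (hc : Continuous f) (hf : Integrable f)
    (h : Integrable fun p : ℝ => (p : ℂ) * fourier f p) {T : A} (hT : IsSelfAdjoint T) (a : A)
    {ρ : ℝ} (hρ : 0 < ρ) :
    ‖cfc (fun z : ℂ => ((f (z.re / ρ) : ℝ) : ℂ)) T * a -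
        a * cfc (fun z : ℂ => ((f (z.re / ρ) : ℝ) : ℂ)) T‖
      ≤ localConst f / 2 / ρ * ‖T * a - a * T‖ := by
  have hi := integrable_fourier_of_integrable_mul hf h
  have hTn : IsStarNormal T := hT.isStarNormal
  set c : ℂ := ((1 / √(2 * Real.pi) : ℝ) : ℂ) with hcdef
  let e : ℝ → ℂ → ℂ := fun p z => fourier f p * Complex.exp (Complex.I * p / ρ * z)
  have hre : ∀ z ∈ spectrum ℂ T, ((z.re : ℝ) : ℂ) = z := fun z hz => (hT.mem_spectrum_eq_re hz).symm
  have hcont : ContinuousOn (Function.uncurry e) (Set.univ ×ˢ spectrum ℂ T) := by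
    have := continuous_fourier_of_integrable hf
    apply Continuous.continuousOn
    simp only [e, Function.uncurry_def]
    fun_prop
  have hbound : ∀ᵐ p : ℝ, ∀ z ∈ spectrum ℂ T, ‖e p z‖ ≤ ‖fourier f p‖ :=
    .of_forall fun p z hz => by
      rw [← hre z hz]
      simp only [e, norm_mul]
      rw [show Complex.I * p / ρ * (z.re : ℂ) = ((p / ρ * z.re : ℝ) : ℂ) * Complex.I by
        push_cast; ring, Complex.norm_exp_ofReal_mul_I, mul_one]
  -- Fourier inversion on the spectrum, with the integral pulled out of the functional calculus; `e
  -- p` applied to `T` is `f̂(p) e^{ipT/ρ}`.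
  have h1 : cfc (fun z : ℂ => ((f (z.re / ρ) : ℝ) : ℂ)) T = c • ∫ p, cfc (e p) T := by
    rw [← cfc_integral e (fun p => ‖fourier f p‖) T hcont hbound hi.norm.2]
    have hcontI : ContinuousOn (fun z => ∫ p, e p z) (spectrum ℂ T) := by
      refine continuousOn_of_dominated (bound := fun p => ‖fourier f p‖) (fun z hz => ?_)
        (fun z hz => ?_) hi.norm (.of_forall fun p => ?_)
      · have := continuous_fourier_of_integrable hf
        apply Continuous.aestronglyMeasurable
        simp only [e]
        fun_prop
      · exact hbound.mono fun p hp => hp z hz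
      · apply Continuous.continuousOn
        simp only [e]
        fun_prop
    rw [← cfc_smul c _ T hcontI]
    refine cfc_congr fun z hz => ?_
    rw [fourier_inversion hc hf hi, smul_eq_mul]
    congr 2
    ext p
    simp only [e]
    conv_rhs => rw [← hre z hz]
    congr 2
    push_cast
    ring
  have hint : Integrable (fun p => cfc (e p) T) :=
    integrable_cfc e (fun p => ‖fourier f p‖) T hcont hbound hi.norm.2
  have h2 : ∀ p, cfc (e p) T = fourier f p • NormedSpace.exp ((p / ρ) • (Complex.I • T)) :=
    fun p => by
    have hn : IsStarNormal ((Complex.I * p / ρ) • T) := by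
      constructor
      rw [star_smul, hT.star_eq]
      exact ((Commute.refl T).smul_left _).smul_right _
    rw [show (p / ρ) • (Complex.I • T) = (Complex.I * p / ρ) • T by
      rw [← Complex.coe_smul, smul_smul]; congr 1; push_cast; ring,
      ← CFC.complex_exp_eq_normedSpace_exp hn, ← cfc_comp_smul _ _ T (by fun_prop),
      ← cfc_smul _ _ T (by fun_prop)]
    rfl
  rw [h1, smul_mul_assoc, mul_smul_comm, ← smul_sub, ← integral_mul_const_of_integrable hint,
    ← integral_const_mul_of_integrable hint, ← integral_sub (hint.mul_const a) (hint.const_mul a),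
    norm_smul]
  have h3 : ∀ p, ‖cfc (e p) T * a - a * cfc (e p) T‖ ≤
      ‖(p : ℂ) * fourier f p‖ * (‖T * a - a * T‖ / ρ) := fun p => by
    rw [h2, smul_mul_assoc, mul_smul_comm, ← smul_sub, norm_smul, norm_mul, Complex.norm_real,
      Real.norm_eq_abs]
    calc _ ≤ ‖fourier f p‖ * (|p / ρ| * ‖T * a - a * T‖) := by
          gcongr
          exact norm_commutator_exp_le hT a _
      _ = _ := by rw [abs_div, abs_of_pos hρ]; ring
  have h4 := norm_integral_le_of_norm_le (h.norm.mul_const (‖T * a - a * T‖ / ρ))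
    (.of_forall h3)
  rw [integral_mul_const] at h4
  have hpi : 0 < √(2 * Real.pi) := by positivity
  calc _ ≤ ‖c‖ * ((∫ p : ℝ, ‖(p : ℂ) * fourier f p‖) * (‖T * a - a * T‖ / ρ)) := by gcongr
    _ = _ := by
      rw [hcdef, Complex.norm_real, Real.norm_of_nonneg (by positivity), localConst]
      field_simp

end BoundedCommutator

theorem norm_eq_one_of_mem_spectrum_of_mem_unitary {A : Type*} [CStarAlgebra A] {u : A}
    (hu : u ∈ unitary A) {z : ℂ} (hz : z ∈ spectrum ℂ u) : ‖z‖ = 1 :=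
  mem_sphere_zero_iff_norm.1 (Unitary.spectrum_subset_circle ⟨u, hu⟩ hz)

/-! ### The resolvent and the Cayley transform -/

section Resolvent

variable {B X : Type*} [NonUnitalCStarAlgebra B] [PartialOrder B] [StarOrderedRing B]
  [NormedAddCommGroup X] [NormedSpace ℂ X] [SMul B X] [CStarModule B X]

namespace SaRegular

variable (D : SaRegular B X)

/-- The cross terms cancel by symmetry of `D`. The right side depends only on `c²`: positivity gives
injectivity of `D + ic`, and comparing `c = 1` with `c = -1` shows that the Cayley transform is
isometric. -/
theorem inner_add_imag_smul (c : ℝ) (x y : D.op.domain) :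
    inner B (D.op x + (c * Complex.I) • (x : X)) (D.op y + (c * Complex.I) • (y : X)) =
      inner B (D.op x) (D.op y) + ((c : ℂ) ^ 2) • inner B (x : X) (y : X) := by
  simp only [CStarModule.inner_add_left, CStarModule.inner_add_right,
    CStarModule.inner_smul_right_complex, CStarModule.inner_smul_left_complex, D.symm]
  have h : ((c : ℂ) * Complex.I) • (star ((c : ℂ) * Complex.I) • inner B (x : X) (y : X)) =
      ((c : ℂ) ^ 2) • inner B (x : X) (y : X) := by
    rw [smul_smul]
    congr 1
    simp only [star_mul', Complex.star_def, Complex.conj_I, Complex.conj_ofReal]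
    linear_combination (-(c : ℂ) ^ 2) * Complex.I_sq
  have h2 : star ((c : ℂ) * Complex.I) = -((c : ℂ) * Complex.I) := by simp
  rw [← h, h2]
  module

theorem eq_zero_of_add_imag_smul_eq_zero {c : ℝ} (hc : c ≠ 0) (x : D.op.domain)
    (h : D.op x + (c * Complex.I) • (x : X) = 0) : (x : X) = 0 := by
  have h1 := D.inner_add_imag_smul c x x
  rw [h, CStarModule.inner_zero_left] at h1
  have h2 : (0 : B) ≤ inner B (D.op x) (D.op x) := CStarModule.inner_self_nonneg
  have h3 : (0 : B) ≤ ((c : ℂ) ^ 2) • inner B (x : X) (x : X) := by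
    have : ((c : ℂ) ^ 2) • inner B (x : X) (x : X) =
        inner B ((c : ℂ) • (x : X)) ((c : ℂ) • (x : X)) := by
      rw [CStarModule.inner_smul_right_complex, CStarModule.inner_smul_left_complex, smul_smul]
      simp [sq]
    rw [this]
    exact CStarModule.inner_self_nonneg
  have h4 : ((c : ℂ) ^ 2) • inner B (x : X) (x : X) = 0 :=
    ((add_eq_zero_iff_of_nonneg h2 h3).1 h1.symm).2
  rw [smul_eq_zero] at h4
  exact CStarModule.inner_self.1 (h4.resolve_left (by simpa using hc))

theorem eq_of_add_imag_smul_eq {c : ℝ} (hc : c ≠ 0) {x y : D.op.domain}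
    (h : D.op x + (c * Complex.I) • (x : X) = D.op y + (c * Complex.I) • (y : X)) :
    (x : X) = y := by
  have h1 := D.eq_zero_of_add_imag_smul_eq_zero hc (x - y) (by
    rw [D.op.map_sub, Submodule.coe_sub, smul_sub, sub_add_sub_comm, h, sub_self])
  rwa [Submodule.coe_sub, sub_eq_zero] at h1

variable [CompleteSpace X]

/-- `R` is the inverse `(D + ic)⁻¹`. -/
def IsResolventAt (c : ℝ) (R : adjointable B X) : Prop :=
  ∀ y : X, ∃ h : R.1 y ∈ D.op.domain, D.op ⟨R.1 y, h⟩ + (c * Complex.I) • R.1 y = y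

theorem isResolventAt_resolvent : D.IsResolventAt 1 D.resolvent := fun y =>
  ⟨D.resolvent_mem y, by simpa using D.resolvent_spec y⟩

variable {D}

theorem IsResolventAt.apply_of_eq {c : ℝ} (hc : c ≠ 0) {R : adjointable B X}
    (hR : D.IsResolventAt c R) (x : D.op.domain) {y : X}
    (h : D.op x + (c * Complex.I) • (x : X) = y) : R.1 y = x := by
  obtain ⟨h1, h2⟩ := hR y
  exact D.eq_of_add_imag_smul_eq hc (x := ⟨R.1 y, h1⟩) (h2.trans h.symm)

/-- The commutator of a resolvent with a Lipschitz operator. -/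
theorem IsResolventAt.commutator {c : ℝ} (hc : c ≠ 0) {R : adjointable B X}
    (hR : D.IsResolventAt c R) {T δ : adjointable B X} (hT : D.IsDeriv T δ) :
    R * T - T * R = -(R * δ * R) := by
  refine Subtype.ext <| ContinuousLinearMap.ext fun y => ?_
  obtain ⟨h1, h2⟩ := hR y
  obtain ⟨h3, h4⟩ := hT ⟨R.1 y, h1⟩
  have h5 := hR.apply_of_eq hc ⟨T.1 (R.1 y), h3⟩ rfl
  change R.1 (T.1 y) - T.1 (R.1 y) = -R.1 (δ.1 (R.1 y))
  rw [← h4]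
  conv_lhs => enter [1, 2, 2]; rw [← h2]
  rw [map_add] at h5
  rw [map_sub, map_add, map_add, eq_sub_of_add_eq h5, T.1.map_smul]
  abel

theorem commute_resolventAt {c : ℝ} (hc : c ≠ 0) {R : adjointable B X}
    (hR : D.IsResolventAt c R) {T : adjointable B X} (hT : D.CommutesWith T) : Commute R T := by
  have h : D.IsDeriv T 0 := fun x => by
    obtain ⟨h1, h2⟩ := hT x
    exact ⟨h1, by rw [h2, sub_self]; rfl⟩
  have := hR.commutator hc h
  rw [mul_zero, zero_mul, neg_zero, sub_eq_zero] at this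
  exact this

variable (D)

theorem cayley_resolvent_sub (y : X) {u : D.op.domain}
    (h : D.op u + Complex.I • (u : X) = y) : D.cayley.1 y = D.op u - Complex.I • (u : X) := by
  have h1 : D.resolvent.1 y = u :=
    D.isResolventAt_resolvent.apply_of_eq one_ne_zero u (by simpa using h)
  have h2 : (⟨D.resolvent.1 y, D.resolvent_mem y⟩ : D.op.domain) = u := Subtype.ext h1
  rw [cayley_apply, h2, h1]

/-- The Cayley transform sends `(D + i)u` to `(D - i)u`. It preserves inner products, and it is onto
because `D - i` is. -/
theorem cayley_mem_unitary : D.cayley ∈ unitary (adjointable B X) := by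
  have h1 : star D.cayley * D.cayley = 1 := adjointable_ext fun x y => by
    change inner B x ((star D.cayley).1 (D.cayley.1 y)) = inner B x y
    rw [inner_star_right]
    obtain ⟨u, hu⟩ := D.surj_add x
    obtain ⟨v, hv⟩ := D.surj_add y
    rw [D.cayley_resolvent_sub x hu, D.cayley_resolvent_sub y hv]
    have e1 := D.inner_add_imag_smul 1 u v
    have e2 := D.inner_add_imag_smul (-1) u v
    simp only [Complex.ofReal_one, one_mul, Complex.ofReal_neg, neg_smul, neg_one_sq,
      neg_mul, ← sub_eq_add_neg] at e1 e2
    rw [e2, ← hu, ← hv, e1, one_pow]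
  have h2 : ∀ z : X, ∃ x, D.cayley.1 x = z := fun z => by
    obtain ⟨u, hu⟩ := D.surj_sub z
    exact ⟨_, (D.cayley_resolvent_sub _ rfl).trans hu⟩
  refine Unitary.mem_iff.2 ⟨h1, Subtype.ext <| ContinuousLinearMap.ext fun z => ?_⟩
  obtain ⟨x, rfl⟩ := h2 z
  change D.cayley.1 ((star D.cayley * D.cayley).1 x) = D.cayley.1 x
  rw [h1]
  rfl

instance isStarNormal_cayley : IsStarNormal D.cayley :=
  ⟨(Unitary.mem_iff.1 D.cayley_mem_unitary).1.trans
    (Unitary.mem_iff.1 D.cayley_mem_unitary).2.symm⟩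

theorem norm_eq_one_of_mem_spectrum_cayley {z : ℂ} (hz : z ∈ spectrum ℂ D.cayley) : ‖z‖ = 1 :=
  norm_eq_one_of_mem_spectrum_of_mem_unitary D.cayley_mem_unitary hz

theorem resolvent_eq : D.resolvent = (2 * Complex.I)⁻¹ • (1 - D.cayley) := by
  rw [cayley, sub_sub_cancel, inv_smul_smul₀ (by simp)]

/-- The range contains the dense domain of `D`. -/
theorem denseRange_resolvent : DenseRange D.resolvent.1 := by
  refine D.dense.mono fun x hx => ⟨D.op ⟨x, hx⟩ + Complex.I • x, ?_⟩
  exact D.isResolventAt_resolvent.apply_of_eq one_ne_zero ⟨x, hx⟩ (by simp)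

end SaRegular
end Resolvent

/-! ### The functional calculus of a selfadjoint and regular operator -/

/-- The inverse Cayley transform, on the unit circle. -/
def invCayley (z : ℂ) : ℝ := (-Complex.I * (z + 1) / (z - 1)).re

/-- On the circle conjugation is inversion, which fixes the quotient. At `z = 1` both sides are `0`
by the convention for division by zero. -/
theorem ofReal_invCayley {z : ℂ} (hz : ‖z‖ = 1) :
    (invCayley z : ℂ) = -Complex.I * (z + 1) / (z - 1) := by
  rcases eq_or_ne z 1 with rfl | h1
  · simp [invCayley]
  have hz' : (starRingEnd ℂ) z = z⁻¹ := (Complex.inv_eq_conj hz).symm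
  have hz0 : z ≠ 0 := by rintro rfl; simp at hz
  have h2 : z - 1 ≠ 0 := sub_ne_zero.2 h1
  have h3 : 1 - z ≠ 0 := sub_ne_zero.2 h1.symm
  refine Complex.conj_eq_iff_re.1 ?_
  simp only [map_div₀, map_mul, map_neg, Complex.conj_I, map_add, map_sub, map_one, hz']
  rw [div_eq_div_iff _ h2]
  · field_simp
    ring
  · intro h
    apply h3
    field_simp at h
    simpa using h

theorem invCayley_add_I {z : ℂ} (hz : ‖z‖ = 1) (h1 : z ≠ 1) :
    ((invCayley z : ℂ) + Complex.I)⁻¹ = (2 * Complex.I)⁻¹ * (1 - z) := by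
  rw [ofReal_invCayley hz]
  have h2 : z - 1 ≠ 0 := sub_ne_zero.2 h1
  have h3 : -Complex.I * (z + 1) / (z - 1) + Complex.I = -2 * Complex.I / (z - 1) := by
    field_simp
    ring
  rw [h3]
  have := Complex.I_ne_zero
  field_simp
  ring

theorem invCayley_conj (z : ℂ) : invCayley (star z) = -invCayley z := by
  have : -Complex.I * (star z + 1) / (star z - 1) =
      -(starRingEnd ℂ) (-Complex.I * (z + 1) / (z - 1)) := by
    simp only [map_div₀, map_mul, map_neg, Complex.conj_I, map_add, map_sub, map_one,
      Complex.star_def]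
    ring
  rw [invCayley, this, invCayley, Complex.neg_re, Complex.conj_re]

/-- The transport of a function on the real line to the unit circle, with value `0` at `1`. -/
def circleFun (f : ℝ → ℂ) (z : ℂ) : ℂ := if z = 1 then 0 else f (invCayley z)

/-- Continuous functions on the real line that vanish at infinity. -/
structure VanishesAtInfty (f : ℝ → ℂ) : Prop where
  continuous : Continuous f
  tendsto : Filter.Tendsto f (Filter.cocompact ℝ) (𝓝 0)

/-- On the circle `|c⁻¹(z)| = |z + 1| / |z - 1|`, which blows up at `1`. -/
theorem tendsto_invCayley : Filter.Tendsto invCayley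
    (𝓝[Metric.sphere (0 : ℂ) 1 \ {1}] 1) (Filter.cocompact ℝ) := by
  rw [← Metric.cobounded_eq_cocompact, ← tendsto_norm_atTop_iff_cobounded]
  have h : (fun z : ℂ => ‖z + 1‖ * ‖z - 1‖⁻¹) =ᶠ[𝓝[Metric.sphere (0 : ℂ) 1 \ {1}] 1]
      fun z => ‖invCayley z‖ := by
    filter_upwards [self_mem_nhdsWithin] with z hz
    rw [← Complex.norm_real, ofReal_invCayley (mem_sphere_zero_iff_norm.1 hz.1)]
    simp [div_eq_mul_inv]
  refine Filter.Tendsto.congr' h ?_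
  have h1 : Filter.Tendsto (fun z : ℂ => ‖z + 1‖) (𝓝[Metric.sphere (0 : ℂ) 1 \ {1}] 1) (𝓝 2) := by
    have : Continuous fun z : ℂ => ‖z + 1‖ := by fun_prop
    have h2 := (this.tendsto 1).mono_left
      (nhdsWithin_le_nhds (s := Metric.sphere (0 : ℂ) 1 \ {1}))
    convert h2 using 2
    norm_num
  refine h1.pos_mul_atTop (by norm_num) (Filter.Tendsto.inv_tendsto_nhdsGT_zero ?_)
  rw [tendsto_nhdsWithin_iff]
  constructor
  · have : Continuous fun z : ℂ => ‖z - 1‖ := by fun_prop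
    have h2 := (this.tendsto 1).mono_left
      (nhdsWithin_le_nhds (s := Metric.sphere (0 : ℂ) 1 \ {1}))
    simpa using h2
  · filter_upwards [self_mem_nhdsWithin] with z hz
    exact norm_pos_iff.2 (sub_ne_zero.2 hz.2)

/-- The point `1` of the circle plays the role of infinity. This continuity is what makes the
continuous functional calculus of the Cayley transform multiplicative on such functions. -/
theorem VanishesAtInfty.continuousOn_circleFun {f : ℝ → ℂ} (hf : VanishesAtInfty f) :
    ContinuousOn (circleFun f) (Metric.sphere (0 : ℂ) 1) := by
  intro z hz
  rcases eq_or_ne z 1 with rfl | h1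
  · rw [← continuousWithinAt_sdiff_self, ContinuousWithinAt]
    have h := hf.tendsto.comp tendsto_invCayley
    rw [show circleFun f 1 = 0 from if_pos rfl]
    refine h.congr' ?_
    filter_upwards [self_mem_nhdsWithin] with w hw
    exact (if_neg hw.2).symm
  · have h : ContinuousAt (fun z => f (invCayley z)) z := by
      refine hf.continuous.continuousAt.comp (Complex.continuous_re.continuousAt.comp ?_)
      exact ContinuousAt.div (by fun_prop) (by fun_prop) (sub_ne_zero.2 h1)
    refine (h.congr ?_).continuousWithinAt
    filter_upwards [isOpen_ne.mem_nhds h1] with w hw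
    exact (if_neg hw).symm

namespace VanishesAtInfty

variable {f g : ℝ → ℂ}

theorem of_hasCompactSupport (hc : Continuous f) (hs : HasCompactSupport f) :
    VanishesAtInfty f := ⟨hc, hs.is_zero_at_infty⟩

theorem of_norm_le (hg : VanishesAtInfty g) (hf : Continuous f) (h : ∀ x, ‖f x‖ ≤ ‖g x‖) :
    VanishesAtInfty f :=
  ⟨hf, squeeze_zero_norm h (by simpa using hg.tendsto.norm)⟩

theorem add (hf : VanishesAtInfty f) (hg : VanishesAtInfty g) :
    VanishesAtInfty fun x => f x + g x :=
  ⟨hf.continuous.add hg.continuous, by simpa using hf.tendsto.add hg.tendsto⟩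

theorem sub (hf : VanishesAtInfty f) (hg : VanishesAtInfty g) :
    VanishesAtInfty fun x => f x - g x :=
  ⟨hf.continuous.sub hg.continuous, by simpa using hf.tendsto.sub hg.tendsto⟩

theorem const_mul (hf : VanishesAtInfty f) (c : ℂ) : VanishesAtInfty fun x => c * f x :=
  ⟨continuous_const.mul hf.continuous, by simpa using hf.tendsto.const_mul c⟩

theorem mul (hf : VanishesAtInfty f) (hg : VanishesAtInfty g) :
    VanishesAtInfty fun x => f x * g x :=
  ⟨hf.continuous.mul hg.continuous, by simpa using hf.tendsto.mul hg.tendsto⟩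

end VanishesAtInfty

theorem norm_ofReal_add_imag_sq (x c : ℝ) :
    ‖(x : ℂ) + c * Complex.I‖ ^ 2 = x ^ 2 + c ^ 2 := by
  rw [← Complex.normSq_eq_norm_sq, Complex.normSq_add_mul_I]

theorem ofReal_add_imag_ne_zero (x : ℝ) {c : ℝ} (hc : c ≠ 0) : (x : ℂ) + c * Complex.I ≠ 0 := by
  intro h
  have h1 := norm_ofReal_add_imag_sq x c
  rw [h] at h1
  have := sq_nonneg x
  have : 0 < c ^ 2 := by positivity
  simp at h1
  linarith

theorem abs_le_norm_ofReal_add_imag (x c : ℝ) : |x| ≤ ‖(x : ℂ) + c * Complex.I‖ := by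
  refine abs_le_of_sq_le_sq ?_ (norm_nonneg _)
  rw [norm_ofReal_add_imag_sq]
  nlinarith [sq_nonneg c]

theorem abs_imag_le_norm_ofReal_add_imag (x c : ℝ) : |c| ≤ ‖(x : ℂ) + c * Complex.I‖ := by
  refine abs_le_of_sq_le_sq ?_ (norm_nonneg _)
  rw [norm_ofReal_add_imag_sq]
  nlinarith [sq_nonneg x]

theorem vanishesAtInfty_inv {c : ℝ} (hc : c ≠ 0) :
    VanishesAtInfty fun x : ℝ => ((x : ℂ) + c * Complex.I)⁻¹ := by
  refine ⟨Continuous.inv₀ (by fun_prop) fun x => ofReal_add_imag_ne_zero x hc, ?_⟩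
  refine Filter.tendsto_inv₀_cobounded.comp ?_
  rw [← tendsto_norm_atTop_iff_cobounded, ← Metric.cobounded_eq_cocompact]
  exact Filter.tendsto_atTop_mono (fun x => abs_le_norm_ofReal_add_imag x c)
    tendsto_norm_cobounded_atTop

/-! ### Algebraic rules, domains and compactness for functions of `D` -/

section Calculus

variable {B X : Type*} [NonUnitalCStarAlgebra B] [PartialOrder B] [StarOrderedRing B]
  [NormedAddCommGroup X] [NormedSpace ℂ X] [SMul B X] [CStarModule B X] [CompleteSpace X]

namespace SaRegular

variable (D : SaRegular B X)

/-- The functional calculus of `D`, for complex valued functions vanishing at infinity. -/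
def funCalc (f : ℝ → ℂ) : adjointable B X := cfc (circleFun f) D.cayley

theorem calc₀_eq_funCalc (f : ℝ → ℝ) : D.calc₀ f = D.funCalc fun x => (f x : ℂ) := rfl

theorem spectrum_cayley_subset : spectrum ℂ D.cayley ⊆ Metric.sphere (0 : ℂ) 1 := fun _ hz =>
  mem_sphere_zero_iff_norm.2 (D.norm_eq_one_of_mem_spectrum_cayley hz)

variable {f g : ℝ → ℂ}

theorem continuousOn_circleFun (hf : VanishesAtInfty f) :
    ContinuousOn (circleFun f) (spectrum ℂ D.cayley) :=
  hf.continuousOn_circleFun.mono D.spectrum_cayley_subset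

theorem funCalc_sub (hf : VanishesAtInfty f) (hg : VanishesAtInfty g) :
    D.funCalc (fun x => f x - g x) = D.funCalc f - D.funCalc g := by
  rw [funCalc, funCalc, funCalc,
    ← cfc_sub _ _ _ (D.continuousOn_circleFun hf) (D.continuousOn_circleFun hg)]
  congr 1
  ext z
  by_cases h : z = 1 <;> simp [circleFun, h]

theorem funCalc_add (hf : VanishesAtInfty f) (hg : VanishesAtInfty g) :
    D.funCalc (fun x => f x + g x) = D.funCalc f + D.funCalc g := by
  rw [funCalc, funCalc, funCalc, ← cfc_add _ _ _ (D.continuousOn_circleFun hf) (D.continuousOn_circleFun hg)]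
  congr 1
  ext z
  by_cases h : z = 1 <;> simp [circleFun, h]

theorem funCalc_mul (hf : VanishesAtInfty f) (hg : VanishesAtInfty g) :
    D.funCalc (fun x => f x * g x) = D.funCalc f * D.funCalc g := by
  rw [funCalc, funCalc, funCalc, ← cfc_mul _ _ _ (D.continuousOn_circleFun hf) (D.continuousOn_circleFun hg)]
  congr 1
  ext z
  by_cases h : z = 1 <;> simp [circleFun, h]

theorem funCalc_const_mul (hf : VanishesAtInfty f) (c : ℂ) :
    D.funCalc (fun x => c * f x) = c • D.funCalc f := by
  rw [funCalc, funCalc, ← cfc_smul _ _ _ (D.continuousOn_circleFun hf)]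
  congr 1
  ext z
  by_cases h : z = 1 <;> simp [circleFun, h]

theorem funCalc_star : D.funCalc (fun x => star (f x)) = star (D.funCalc f) := by
  rw [funCalc, funCalc, ← cfc_star]
  congr 1
  ext z
  by_cases h : z = 1 <;> simp [circleFun, h]

theorem isSelfAdjoint_funCalc (h : ∀ x, star (f x) = f x) : IsSelfAdjoint (D.funCalc f) := by
  rw [IsSelfAdjoint, ← funCalc_star]
  simp_rw [h]

theorem norm_funCalc_le {M : ℝ} (hM : 0 ≤ M) (h : ∀ x, ‖f x‖ ≤ M) : ‖D.funCalc f‖ ≤ M := by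
  refine norm_cfc_le hM fun z _ => ?_
  by_cases h1 : z = 1
  · simpa [circleFun, h1] using hM
  · simpa [circleFun, h1] using h _

theorem funCalc_inv_add_I : D.funCalc (fun x => ((x : ℂ) + (1 : ℝ) * Complex.I)⁻¹) = D.resolvent := by
  have h : D.funCalc (fun x => ((x : ℂ) + (1 : ℝ) * Complex.I)⁻¹) =
      cfc (fun z : ℂ => (2 * Complex.I)⁻¹ • (1 - z)) D.cayley := by
    refine cfc_congr fun z hz => ?_
    by_cases h1 : z = 1
    · simp [circleFun, h1]
    · have := invCayley_add_I (D.norm_eq_one_of_mem_spectrum_cayley hz) h1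
      simpa [circleFun, h1] using this
  rw [h, resolvent_eq, cfc_smul _ _ _ (by fun_prop), cfc_sub _ _ _ (by fun_prop) (by fun_prop),
    cfc_id' .., cfc_const_one ..]

/-- If `f` and `x f(x)` vanish at infinity, then `f(D)` maps into the domain of `D`. -/
theorem funCalc_eq_resolvent_mul (hf : VanishesAtInfty f)
    (hg : VanishesAtInfty fun x => (x : ℂ) * f x) :
    D.funCalc f = D.resolvent * (D.funCalc (fun x => (x : ℂ) * f x) + Complex.I • D.funCalc f) := by
  rw [← D.funCalc_const_mul hf, ← D.funCalc_add hg (hf.const_mul _), ← D.funCalc_inv_add_I,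
    ← D.funCalc_mul (vanishesAtInfty_inv one_ne_zero) (hg.add (hf.const_mul _))]
  congr 1
  ext x
  rw [← add_mul, Complex.ofReal_one, one_mul, inv_mul_cancel_left₀]
  simpa using ofReal_add_imag_ne_zero x (c := 1) one_ne_zero

/-- This is `D (D + i)⁻¹ = 1 - i (D + i)⁻¹`. -/
theorem isComp_resolvent_mul (T : adjointable B X) :
    D.IsComp (D.resolvent * T) (T - Complex.I • (D.resolvent * T)) := fun y =>
  ⟨D.resolvent_mem _, eq_sub_of_add_eq (D.resolvent_spec (T.1 y))⟩

theorem isComp_funCalc (hf : VanishesAtInfty f) (hg : VanishesAtInfty fun x => (x : ℂ) * f x) :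
    D.IsComp (D.funCalc f) (D.funCalc fun x => (x : ℂ) * f x) := by
  have h := D.isComp_resolvent_mul (D.funCalc (fun x => (x : ℂ) * f x) + Complex.I • D.funCalc f)
  rwa [← D.funCalc_eq_resolvent_mul hf hg, add_sub_cancel_right] at h

/-- The scalar resolvent identity `(x + ic)⁻¹ = (x + i)⁻¹ (1 + i(1 - c)(x + ic)⁻¹)` puts the range
into the domain of `D`, and then determines `D` on it. -/
theorem isResolventAt_funCalc {c : ℝ} (hc : c ≠ 0) :
    D.IsResolventAt c (D.funCalc fun x => ((x : ℂ) + c * Complex.I)⁻¹) := by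
  have hv := vanishesAtInfty_inv hc
  have h1 := vanishesAtInfty_inv one_ne_zero
  set R := D.funCalc fun x => ((x : ℂ) + c * Complex.I)⁻¹ with hR
  have e : R = D.resolvent * (1 + (Complex.I * (1 - c)) • R) := by
    rw [mul_add, mul_one, mul_smul_comm, ← D.funCalc_inv_add_I, hR, ← D.funCalc_mul h1 hv,
      ← D.funCalc_const_mul (h1.mul hv), ← D.funCalc_add h1 ((h1.mul hv).const_mul _)]
    congr 1
    ext x
    have := ofReal_add_imag_ne_zero x hc
    have h2 := ofReal_add_imag_ne_zero x one_ne_zero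
    rw [Complex.ofReal_one, one_mul] at h2 ⊢
    field_simp
    ring
  have h := D.isComp_resolvent_mul (1 + (Complex.I * (1 - c)) • R)
  rw [← e] at h
  intro y
  obtain ⟨h1, h2⟩ := h y
  refine ⟨h1, ?_⟩
  rw [h2]
  change y + (Complex.I * (1 - c)) • R.1 y - Complex.I • R.1 y + (c * Complex.I) • R.1 y = y
  module

theorem funCalc_mem_compacts (hK : D.resolvent ∈ (compacts B X).toSubmodule)
    (hf : VanishesAtInfty f) (hg : VanishesAtInfty fun x => (x : ℂ) * f x) :
    D.funCalc f ∈ (compacts B X).toSubmodule := by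
  rw [D.funCalc_eq_resolvent_mul hf hg]
  exact (compacts B X).mul_mem_right _ hK

theorem commute_funCalc {T : adjointable B X} (hT : IsSelfAdjoint T) (h : D.CommutesWith T) :
    Commute (D.funCalc f) T := by
  have h1 : Commute D.cayley T := by
    have := commute_resolventAt one_ne_zero D.isResolventAt_resolvent h
    exact (Commute.one_left T).sub_left (this.smul_left _)
  refine h1.cfc ?_ _
  have := h1.star_star
  rwa [hT.star_eq] at this

theorem commute_funCalc_funCalc : Commute (D.funCalc f) (D.funCalc g) := cfc_commute_cfc _ _ _

end SaRegular
end Calculus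

/-! ### Commutators with functions of a selfadjoint and regular operator -/

/-- The bounded approximation `c² x (x² + c²)⁻¹` of the identity function. -/
def yosidaFun (c x : ℝ) : ℝ := c ^ 2 * x / (x ^ 2 + c ^ 2)

theorem ofReal_yosidaFun {c : ℝ} (hc : c ≠ 0) (x : ℝ) : (yosidaFun c x : ℂ) =
    (c : ℂ) ^ 2 / 2 * (((x : ℂ) + c * Complex.I)⁻¹ + ((x : ℂ) + (-c : ℝ) * Complex.I)⁻¹) := by
  have h1 := ofReal_add_imag_ne_zero x hc
  have h2 := ofReal_add_imag_ne_zero x (neg_ne_zero.2 hc)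
  have h3 : ((x : ℂ) ^ 2 + c ^ 2) ≠ 0 := by
    have : 0 < x ^ 2 + c ^ 2 := by positivity
    exact_mod_cast this.ne'
  have h4 : ((x : ℂ) + c * Complex.I) * ((x : ℂ) + (-c : ℝ) * Complex.I) = x ^ 2 + c ^ 2 := by
    push_cast
    linear_combination (-(c : ℂ) ^ 2) * Complex.I_sq
  rw [inv_add_inv h1 h2, h4, yosidaFun]
  push_cast
  field_simp
  ring

theorem vanishesAtInfty_yosidaFun {c : ℝ} (hc : c ≠ 0) :
    VanishesAtInfty fun x => (yosidaFun c x : ℂ) := by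
  simp_rw [ofReal_yosidaFun hc]
  exact ((vanishesAtInfty_inv hc).add (vanishesAtInfty_inv (neg_ne_zero.2 hc))).const_mul _

theorem abs_yosidaFun_sub_le {c m x : ℝ} (hc : c ≠ 0) (hx : |x| ≤ m) :
    |yosidaFun c x - x| ≤ m ^ 3 / c ^ 2 := by
  have hc2 : 0 < c ^ 2 := by positivity
  have h : yosidaFun c x - x = -(x ^ 3 / (x ^ 2 + c ^ 2)) := by
    rw [yosidaFun]
    field_simp
    ring
  rw [h, abs_neg, abs_div, abs_pow, abs_of_pos (by positivity : 0 < x ^ 2 + c ^ 2)]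
  exact div_le_div₀ (pow_nonneg ((abs_nonneg x).trans hx) 3)
    (pow_le_pow_left₀ (abs_nonneg x) hx 3) hc2 (by nlinarith [sq_nonneg x])

/-- For `|x| ≤ m` the approximation is uniformly close to `x`, and uniform continuity applies. For
`|x| ≥ m` the difference is at most `2`, and the resolvent factor is at most `1/m = ε/2`. -/
theorem exists_norm_comp_yosidaFun_sub_mul_inv_le {f : ℝ → ℝ} (hf : UniformContinuous f)
    (hf1 : ∀ x, |f x| ≤ 1) {ε : ℝ} (hε : 0 < ε) : ∃ c₀ : ℝ, ∀ c, c₀ ≤ c → ∀ x,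
      ‖((f (yosidaFun c x) : ℂ) - f x) * ((x : ℂ) + (1 : ℝ) * Complex.I)⁻¹‖ ≤ ε := by
  obtain ⟨δ, hδ, h⟩ := Metric.uniformContinuous_iff.1 hf ε hε
  set m : ℝ := 2 / ε with hm
  have hm0 : 0 < m := by positivity
  -- This choice gives `c > 1` and `c > m³/δ`, hence `m³/c² < δ`.
  refine ⟨m ^ 3 / δ + 1, fun c hc x => ?_⟩
  have hm3 : 0 < m ^ 3 / δ := by positivity
  have hc1 : 1 < c := by linarith
  rw [norm_mul, norm_inv, ← Complex.ofReal_sub, Complex.norm_real, Real.norm_eq_abs]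
  rcases le_total |x| m with hx | hx
  · have h1 : |yosidaFun c x - x| < δ := by
      refine (abs_yosidaFun_sub_le (by positivity) hx).trans_lt ?_
      rw [div_lt_iff₀ (by positivity)]
      rw [div_add_one hδ.ne', div_le_iff₀ hδ] at hc
      nlinarith [mul_le_mul_of_nonneg_left hc (by linarith : (0 : ℝ) ≤ c), pow_pos hm0 3]
    have h2 := h h1
    rw [Real.dist_eq] at h2
    have h3 := abs_imag_le_norm_ofReal_add_imag x 1
    rw [abs_one] at h3
    calc _ ≤ ε * 1 := by
          gcongr
          exact inv_le_one_of_one_le₀ h3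
      _ = ε := mul_one ε
  · have h1 : |f (yosidaFun c x) - f x| ≤ 2 := by
      have := abs_le.1 (hf1 (yosidaFun c x))
      have := abs_le.1 (hf1 x)
      rw [abs_le]
      constructor <;> linarith
    have h2 := hx.trans (abs_le_norm_ofReal_add_imag x 1)
    calc _ ≤ 2 * m⁻¹ := by gcongr
      _ = ε := by rw [hm]; field_simp

section

variable {B X : Type*} [NonUnitalCStarAlgebra B] [PartialOrder B] [StarOrderedRing B]
  [NormedAddCommGroup X] [NormedSpace ℂ X] [SMul B X] [CStarModule B X] [CompleteSpace X]

namespace SaRegular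

variable (D : SaRegular B X)

/-- The approximation is `c²/2` times the sum of the resolvents at `±ic`. Each resolvent `R` has
norm at most `1/c` and commutator `-R δ R`, so the factors of `c` cancel exactly. -/
theorem norm_commutator_yosida_le {c : ℝ} (hc : 0 < c) {T δ : adjointable B X}
    (hT : D.IsDeriv T δ) :
    ‖D.funCalc (fun x => (yosidaFun c x : ℂ)) * T - T * D.funCalc (fun x => (yosidaFun c x : ℂ))‖
      ≤ ‖δ‖ := by
  have hc' : -c ≠ 0 := neg_ne_zero.2 hc.ne'
  have hn : ∀ c' : ℝ, |c'| = c → c' ≠ 0 →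
      ‖D.funCalc fun x => ((x : ℂ) + c' * Complex.I)⁻¹‖ ≤ c⁻¹ := fun c' h h0 => by
    refine D.norm_funCalc_le (by positivity) fun x => ?_
    rw [norm_inv, ← h]
    have := abs_imag_le_norm_ofReal_add_imag x c'
    gcongr
  have e : D.funCalc (fun x => (yosidaFun c x : ℂ)) = ((c : ℂ) ^ 2 / 2) •
      (D.funCalc (fun x => ((x : ℂ) + c * Complex.I)⁻¹) +
        D.funCalc (fun x => ((x : ℂ) + (-c : ℝ) * Complex.I)⁻¹)) := by
    simp_rw [ofReal_yosidaFun hc.ne']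
    rw [D.funCalc_const_mul ((vanishesAtInfty_inv hc.ne').add (vanishesAtInfty_inv hc')),
      D.funCalc_add (vanishesAtInfty_inv hc.ne') (vanishesAtInfty_inv hc')]
  have h1 := (D.isResolventAt_funCalc hc.ne').commutator hc.ne' hT
  have h2 := (D.isResolventAt_funCalc hc').commutator hc' hT
  have n1 := hn c (abs_of_pos hc) hc.ne'
  have n2 := hn (-c) (by rw [abs_neg, abs_of_pos hc]) hc'
  rw [e]
  set R := D.funCalc fun x => ((x : ℂ) + c * Complex.I)⁻¹
  set S := D.funCalc fun x => ((x : ℂ) + (-c : ℝ) * Complex.I)⁻¹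
  have e2 : ((c : ℂ) ^ 2 / 2) • (R + S) * T - T * (((c : ℂ) ^ 2 / 2) • (R + S)) =
      ((c : ℂ) ^ 2 / 2) • (-(R * δ * R) + -(S * δ * S)) := by
    rw [← h1, ← h2, smul_mul_assoc, mul_smul_comm, ← smul_sub]
    congr 1
    noncomm_ring
  have n3 : ∀ V : adjointable B X, ‖V‖ ≤ c⁻¹ → ‖-(V * δ * V)‖ ≤ c⁻¹ * ‖δ‖ * c⁻¹ := fun V hV => by
    rw [norm_neg]
    calc _ ≤ ‖V‖ * ‖δ‖ * ‖V‖ := norm_mul₃_le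
      _ ≤ _ := by gcongr
  rw [e2, norm_smul]
  calc _ ≤ ‖(c : ℂ) ^ 2 / 2‖ * (c⁻¹ * ‖δ‖ * c⁻¹ + c⁻¹ * ‖δ‖ * c⁻¹) := by
        gcongr
        exact (norm_add_le _ _).trans (add_le_add (n3 R n1) (n3 S n2))
    _ = ‖δ‖ := by
      rw [norm_div, norm_pow, Complex.norm_real, Real.norm_of_nonneg hc.le, Complex.norm_ofNat]
      field_simp
      ring

/-- The function `f(yosidaFun c x)` tends to `f 0` at infinity, which need not vanish. The resolvent
factor is `0` at the point `z = 1`, so the product is again given by a function vanishing at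
infinity. -/
theorem cfc_yosida_mul_resolvent {f : ℝ → ℝ} (hf : Continuous f) {c : ℝ} (hc : c ≠ 0) :
    cfc (fun z : ℂ => (f z.re : ℂ)) (D.funCalc fun x => (yosidaFun c x : ℂ)) * D.resolvent =
      D.funCalc fun x => (f (yosidaFun c x) : ℂ) * ((x : ℂ) + (1 : ℝ) * Complex.I)⁻¹ := by
  have h1 := D.continuousOn_circleFun (vanishesAtInfty_yosidaFun hc)
  have hf' : Continuous fun z : ℂ => (f z.re : ℂ) := by fun_prop
  rw [← D.funCalc_inv_add_I, funCalc, funCalc, funCalc, ← cfc_comp' _ _ _ hf'.continuousOn h1,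
    
    ← cfc_mul (fun z => (f (circleFun (fun x => (yosidaFun c x : ℂ)) z).re : ℂ)) _ _
      (hf'.comp_continuousOn h1)
      (D.continuousOn_circleFun (vanishesAtInfty_inv one_ne_zero))]
  congr 1
  ext z
  by_cases h : z = 1 <;> simp [circleFun, h]

theorem tendsto_cfc_yosida_mul_resolvent {f : ℝ → ℝ} (hf : UniformContinuous f)
    (hf1 : ∀ x, |f x| ≤ 1) (hf0 : VanishesAtInfty fun x => (f x : ℂ)) :
    Filter.Tendsto (fun c : ℝ => (cfc (fun z : ℂ => (f z.re : ℂ))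
        (D.funCalc fun x => (yosidaFun c x : ℂ)) - D.funCalc fun x => (f x : ℂ)) * D.resolvent)
      Filter.atTop (𝓝 0) := by
  rw [Metric.tendsto_atTop]
  intro ε hε
  obtain ⟨c₀, h⟩ := exists_norm_comp_yosidaFun_sub_mul_inv_le hf hf1 (half_pos hε)
  refine ⟨max c₀ 1, fun c hc => ?_⟩
  have hc0 : c ≠ 0 := by
    have := (le_max_right _ _).trans hc
    positivity
  have hv := vanishesAtInfty_inv one_ne_zero
  have hv1 : VanishesAtInfty fun x =>
      (f (yosidaFun c x) : ℂ) * ((x : ℂ) + (1 : ℝ) * Complex.I)⁻¹ := by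
    refine hv.of_norm_le ?_ fun x => ?_
    · have h1 : Continuous (yosidaFun c) := by
        unfold yosidaFun
        exact Continuous.div (by fun_prop) (by fun_prop) fun x => by positivity
      exact (Complex.continuous_ofReal.comp (hf.continuous.comp h1)).mul hv.continuous
    · rw [norm_mul, Complex.norm_real]
      exact mul_le_of_le_one_left (norm_nonneg _) (hf1 _)
  have e : (cfc (fun z : ℂ => (f z.re : ℂ))
        (D.funCalc fun x => (yosidaFun c x : ℂ)) - D.funCalc fun x => (f x : ℂ)) * D.resolvent =
      D.funCalc fun x =>
        ((f (yosidaFun c x) : ℂ) - f x) * ((x : ℂ) + (1 : ℝ) * Complex.I)⁻¹ := by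
    rw [sub_mul, D.cfc_yosida_mul_resolvent hf.continuous hc0, ← D.funCalc_inv_add_I,
      ← D.funCalc_mul hf0 hv, sub_eq_add_neg, ← neg_one_smul ℂ, ← D.funCalc_const_mul (hf0.mul hv),
      ← D.funCalc_add hv1 ((hf0.mul hv).const_mul _)]
    congr 1
    ext x
    ring
  rw [dist_zero_right, e]
  exact (D.norm_funCalc_le (half_pos hε).le (h c ((le_max_left _ _).trans hc))).trans_lt
    (half_lt_self hε)

theorem norm_cfc_yosida_le {f : ℝ → ℝ} (hf1 : ∀ x, |f x| ≤ 1) (c : ℝ) :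
    ‖cfc (fun z : ℂ => (f z.re : ℂ)) (D.funCalc fun x => (yosidaFun c x : ℂ))‖ ≤ 1 :=
  norm_cfc_le zero_le_one fun z _ => by
    rw [Complex.norm_real]
    exact hf1 _

/-- Norm convergence after composition with the resolvent is convergence on its dense range. The
uniform bound `2` on the differences extends it to every vector. -/
theorem tendsto_cfc_yosida_apply {f : ℝ → ℝ} (hf : UniformContinuous f)
    (hf1 : ∀ x, |f x| ≤ 1) (hf0 : VanishesAtInfty fun x => (f x : ℂ)) (y : X) :
    Filter.Tendsto (fun c : ℝ => (cfc (fun z : ℂ => (f z.re : ℂ))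
        (D.funCalc fun x => (yosidaFun c x : ℂ)) - D.funCalc fun x => (f x : ℂ)).1 y)
      Filter.atTop (𝓝 0) := by
  have h := D.tendsto_cfc_yosida_mul_resolvent hf hf1 hf0
  set F : ℝ → adjointable B X := fun c => cfc (fun z : ℂ => (f z.re : ℂ))
        (D.funCalc fun x => (yosidaFun c x : ℂ)) - D.funCalc fun x => (f x : ℂ)
  have hF : ∀ c, ‖(F c).1‖ ≤ 2 := fun c => by
    change ‖F c‖ ≤ 2
    refine (norm_sub_le _ _).trans ?_
    have h1 := D.norm_cfc_yosida_le hf1 c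
    have h2 : ‖D.funCalc fun x => (f x : ℂ)‖ ≤ 1 := D.norm_funCalc_le zero_le_one fun x => by
      rw [Complex.norm_real]
      exact hf1 x
    linarith
  rw [Metric.tendsto_atTop] at h ⊢
  intro ε hε
  obtain ⟨w, hw⟩ := D.denseRange_resolvent.exists_dist_lt y (by positivity : 0 < ε / 4)
  obtain ⟨c₀, h0⟩ := h (ε / 2 / (‖w‖ + 1)) (by positivity)
  refine ⟨c₀, fun c hc => ?_⟩
  have h1 := h0 c hc
  rw [dist_zero_right] at h1 ⊢
  have h2 : (F c).1 y = (F c).1 (y - D.resolvent.1 w) + (F c * D.resolvent).1 w := by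
    rw [map_sub]
    exact (sub_add_cancel _ _).symm
  rw [h2]
  rw [dist_eq_norm] at hw
  have h3 : ‖(F c * D.resolvent).1 w‖ ≤ ε / 2 / (‖w‖ + 1) * ‖w‖ :=
    ((F c * D.resolvent).1.le_opNorm w).trans (by gcongr; exact h1.le)
  have h4 : ε / 2 / (‖w‖ + 1) * ‖w‖ ≤ ε / 2 := by
    rw [div_mul_eq_mul_div, div_le_iff₀ (by positivity)]
    nlinarith
  have h5 : ‖(F c).1 (y - D.resolvent.1 w)‖ ≤ 2 * ‖y - D.resolvent.1 w‖ :=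
    ((F c).1.le_opNorm _).trans (by gcongr; exact hF c)
  calc _ ≤ ‖(F c).1 (y - D.resolvent.1 w)‖ + ‖(F c * D.resolvent).1 w‖ := norm_add_le _ _
    _ < ε := by linarith

/-- The commutator estimate for functions of an unbounded selfadjoint operator. -/
theorem norm_commutator_funCalc_le {f : ℝ → ℝ} (hc : Continuous f) (hcs : HasCompactSupport f)
    (hf1 : ∀ x, |f x| ≤ 1)
    (hF : MeasureTheory.Integrable fun p : ℝ => (p : ℂ) * fourier f p) {ρ : ℝ} (hρ : 0 < ρ)
    {T δ : adjointable B X} (hT : D.IsDeriv T δ) :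
    ‖D.funCalc (fun x => (f (x / ρ) : ℂ)) * T - T * D.funCalc (fun x => (f (x / ρ) : ℂ))‖
      ≤ localConst f / 2 / ρ * ‖δ‖ := by
  have hcsρ : HasCompactSupport fun x => f (x / ρ) := by
    have := hcs.comp_homeomorph (Homeomorph.mulRight₀ ρ⁻¹ (inv_ne_zero hρ.ne'))
    simpa [Function.comp_def, div_eq_mul_inv] using this
  have hcρ : Continuous fun x => f (x / ρ) := by fun_prop
  have hu : UniformContinuous fun x => f (x / ρ) := hcsρ.uniformContinuous_of_continuous hcρ
  have h0 : VanishesAtInfty fun x => (f (x / ρ) : ℂ) :=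
    .of_hasCompactSupport (by fun_prop) (hcsρ.comp_left (g := Complex.ofReal) rfl)
  have ht := D.tendsto_cfc_yosida_apply hu (fun x => hf1 (x / ρ)) h0
  set F : adjointable B X := D.funCalc fun x => (f (x / ρ) : ℂ)
  set G : ℝ → adjointable B X := fun c => cfc (fun z : ℂ => (f (z.re / ρ) : ℂ))
        (D.funCalc fun x => (yosidaFun c x : ℂ)) with hG
  have hb : ∀ c : ℝ, 0 < c → ‖G c * T - T * G c‖ ≤ localConst f / 2 / ρ * ‖δ‖ := fun c hc' => by
    have hsa : IsSelfAdjoint (D.funCalc fun x => (yosidaFun c x : ℂ)) :=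
      D.isSelfAdjoint_funCalc fun x => Complex.conj_ofReal _
    have h1 := norm_commutator_cfc_le hc (hc.integrable_of_hasCompactSupport hcs) hF hsa T hρ
    have hpos : 0 ≤ localConst f / 2 / ρ := by
      unfold localConst
      have : 0 ≤ ∫ p : ℝ, ‖(p : ℂ) * fourier f p‖ :=
        MeasureTheory.integral_nonneg fun _ => norm_nonneg _
      positivity
    exact h1.trans (mul_le_mul_of_nonneg_left (D.norm_commutator_yosida_le hc' hT) hpos)
  -- The convergence is only strong, so the norm bound is passed to the limit one vector at a time.
  refine (F * T - T * F).1.opNorm_le_bound ?_ fun y => ?_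
  · exact (norm_nonneg _).trans (hb 1 one_pos)
  have ht' : Filter.Tendsto (fun c : ℝ => localConst f / 2 / ρ * ‖δ‖ * ‖y‖ +
      ‖(G c - F).1 (T.1 y)‖ + ‖T‖ * ‖(G c - F).1 y‖) Filter.atTop
      (𝓝 (localConst f / 2 / ρ * ‖δ‖ * ‖y‖)) := by
    have := (tendsto_const_nhds (x := localConst f / 2 / ρ * ‖δ‖ * ‖y‖)).add (ht (T.1 y)).norm
    have := this.add ((ht y).norm.const_mul ‖T‖)
    simpa using this
  refine ge_of_tendsto ht' ?_
  filter_upwards [Filter.eventually_gt_atTop 0] with c hc0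
  have e : (F * T - T * F).1 y =
      (G c * T - T * G c).1 y - (G c - F).1 (T.1 y) + T.1 ((G c - F).1 y) := by
    change F.1 (T.1 y) - T.1 (F.1 y) = (G c).1 (T.1 y) - T.1 ((G c).1 y) -
      ((G c).1 (T.1 y) - F.1 (T.1 y)) + T.1 ((G c).1 y - F.1 y)
    rw [map_sub]
    abel
  rw [e]
  have h1 : ‖(G c * T - T * G c).1 y‖ ≤ localConst f / 2 / ρ * ‖δ‖ * ‖y‖ :=
    ((G c * T - T * G c).1.le_opNorm y).trans (by gcongr; exact hb c hc0)
  have h2 : ‖T.1 ((G c - F).1 y)‖ ≤ ‖T‖ * ‖(G c - F).1 y‖ := T.1.le_opNorm _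
  calc _ ≤ _ := norm_add_le _ _
    _ ≤ ‖(G c * T - T * G c).1 y‖ + ‖(G c - F).1 (T.1 y)‖ + ‖T.1 ((G c - F).1 y)‖ := by
      gcongr
      exact norm_sub_le _ _
    _ ≤ _ := by gcongr

end SaRegular
end

/-! ### Positivity of commuting selfadjoint elements -/

/-- A commuting family of selfadjoint elements of a C*-algebra is contained in a real algebra in
which positivity is tested by real valued evaluations, the characters. -/
theorem exists_real_evaluations.{u} {A : Type u} [CStarAlgebra A] [PartialOrder A] [StarOrderedRing A]
    (s : Set A) (hsa : ∀ a ∈ s, IsSelfAdjoint a) (hcomm : ∀ a ∈ s, ∀ b ∈ s, a * b = b * a) :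
    ∃ (Y : Type u) (S : Subalgebra ℝ A) (ev : Y → S →ₐ[ℝ] ℝ), s ⊆ S ∧
      ∀ a : S, (0 : A) ≤ a ↔ ∀ y, 0 ≤ ev y a := by
  have hstar : s ∪ star s = s := by
    refine Set.union_eq_left.2 fun a ha => ?_
    have := hsa _ ha
    rw [← star_star a, this.star_eq]
    exact ha
  -- The bicommutant of a commuting selfadjoint family is a commutative C*-algebra. Its characters
  -- are real on selfadjoint elements and, by spectral permanence, compute their spectra in `A`.
  let C : StarSubalgebra ℂ A := StarSubalgebra.centralizer ℂ (StarSubalgebra.centralizer ℂ s)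
  have hCs : ∀ a, a ∈ StarSubalgebra.centralizer ℂ s ↔ ∀ g ∈ s, g * a = a * g := fun a => by
    change a ∈ Set.centralizer (s ∪ star s) ↔ _
    rw [hstar]
    rfl
  have hC : ∀ a, a ∈ C ↔ ∀ g ∈ StarSubalgebra.centralizer ℂ s, g * a = a * g := fun a => by
    change a ∈ Set.centralizer (_ ∪ star _) ↔ _
    rw [Set.union_eq_left.2 fun b hb => star_star b ▸ star_mem (Set.mem_star.1 hb)]
    rfl
  have hsC : ∀ a ∈ s, a ∈ C := fun a ha => (hC a).2 fun g hg => ((hCs g).1 hg a ha).symm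
  have hC_comm : ∀ a ∈ C, ∀ b ∈ C, a * b = b * a := fun a ha b hb => by
    refine (hC b).1 hb a ((hCs a).2 fun g hg => ?_)
    exact (hC a).1 ha g ((hCs g).2 fun g' hg' => hcomm g' hg' g hg)
  have hCcl : IsClosed (C : Set A) := Set.isClosed_centralizer _
  let iC : CStarAlgebra C := StarSubalgebra.cstarAlgebra C (h_closed := hCcl)
  let iC' : CommCStarAlgebra C :=
    { iC with mul_comm := fun a b => Subtype.ext (hC_comm a a.2 b b.2) }
  let S : Subalgebra ℝ A :=
    { carrier := {a | a ∈ C ∧ IsSelfAdjoint a}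
      mul_mem' := fun {a b} ha hb => ⟨mul_mem ha.1 hb.1, by
        rw [IsSelfAdjoint, star_mul, ha.2.star_eq, hb.2.star_eq, hC_comm b hb.1 a ha.1]⟩
      add_mem' := fun ha hb => ⟨add_mem ha.1 hb.1, ha.2.add hb.2⟩
      algebraMap_mem' := fun r => ⟨C.algebraMap_mem (r : ℂ), IsSelfAdjoint.algebraMap A
        (IsSelfAdjoint.all r)⟩ }
  have hre : ∀ (χ : WeakDual.characterSpace ℂ C) (a : S),
      ((χ ⟨a, a.2.1⟩).re : ℂ) = χ ⟨a, a.2.1⟩ := fun χ a => by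
    have h : IsSelfAdjoint (⟨a, a.2.1⟩ : C) := Subtype.ext a.2.2
    exact Complex.conj_eq_iff_re.1 ((map_star χ _).symm.trans (congrArg χ h.star_eq))
  let ev : WeakDual.characterSpace ℂ C → S →ₐ[ℝ] ℝ := fun χ =>
    { toFun := fun a => (χ ⟨a, a.2.1⟩).re
      map_one' := by
        change (χ 1).re = 1
        simp
      map_zero' := by
        change (χ 0).re = 0
        simp
      map_add' := fun a b => by
        change (χ (⟨a, a.2.1⟩ + ⟨b, b.2.1⟩)).re = _
        rw [map_add, Complex.add_re]
      map_mul' := fun a b => by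
        change (χ (⟨a, a.2.1⟩ * ⟨b, b.2.1⟩)).re = _
        rw [map_mul, ← hre χ a, ← hre χ b, ← Complex.ofReal_mul, Complex.ofReal_re,
          Complex.ofReal_re, Complex.ofReal_re]
      commutes' := fun r => by
        change (χ (algebraMap ℂ C r)).re = r
        rw [AlgHomClass.commutes]
        rfl }
  refine ⟨_, S, ev, fun a ha => ⟨hsC a ha, hsa a ha⟩, fun a => ?_⟩
  rw [StarOrderedRing.nonneg_iff_spectrum_nonneg (R := ℝ) (a : A) a.2.2]
  have hsp : ∀ r : ℝ, r ∈ spectrum ℝ (a : A) ↔ ∃ χ : WeakDual.characterSpace ℂ C, ev χ a = r := by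
    intro r
    rw [← spectrum.algebraMap_mem_iff ℂ]
    have h1 : spectrum ℂ (⟨a, a.2.1⟩ : C) = spectrum ℂ (a : A) :=
      StarSubalgebra.spectrum_eq C
    rw [← h1, WeakDual.CharacterSpace.mem_spectrum_iff_exists]
    refine exists_congr fun χ => ?_
    rw [← hre χ a]
    exact Complex.ofReal_inj
  constructor
  · exact fun h χ => h _ ((hsp _).2 ⟨χ, rfl⟩)
  · intro h r hr
    obtain ⟨χ, rfl⟩ := (hsp r).1 hr
    exact h χ

/-! ### Invertibility of localizers -/

section Localizer

/-- The pointwise form of the lower bound for the square of a localizer. -/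
theorem localizer_pointwise_bound {φ ψ ω p k r κ g δ c t : ℝ} (hφ₀ : 0 ≤ φ) (hφ₁ : φ ≤ 1)
    (hψ₀ : 0 ≤ ψ) (hψ₁ : ψ ≤ 1) (hpp : p * p = p) (hpφ : p * φ = φ) (hpψ : p * ψ = p)
    (hωψ : ω * ψ = ψ) (hk : 0 ≤ (k * k - r ^ 2 * (ω * ω)) * (1 - φ)) (ht₀ : 0 ≤ t) (ht₁ : t ≤ 1)
    (hg : 0 ≤ g) (hδ : 0 ≤ δ) (hc₁ : c ≤ 1) (hc₂ : c ≤ g - δ) (hc₃ : c ≤ κ ^ 2 * r ^ 2 - δ) :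
    0 ≤ ((1 - t) * φ + t * p) * ((1 - t) * φ + t * p) - φ * φ ∧
    0 ≤ 1 - ((1 - t) * ψ + t * p) ^ 4 ∧
    0 ≤ g * (((1 - t) * φ + t * p) * (φ * φ) * ((1 - t) * φ + t * p)) -
      δ * (((1 - t) * φ + t * p) * ((1 - t) * φ + t * p)) +
      κ ^ 2 * (((1 - t) * ψ + t * p) ^ 4 * (k * k)) + (1 - ((1 - t) * ψ + t * p) ^ 4) - c := by
  have hp : p = 0 ∨ p = 1 := by
    have : p * (p - 1) = 0 := by linarith
    rcases mul_eq_zero.1 this with h | h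
    · exact .inl h
    · exact .inr (by linarith)
  have hk' : φ < 1 → ω = 1 → r ^ 2 ≤ k * k := fun h hω => by
    have := nonneg_of_mul_nonneg_left hk (by linarith)
    rw [hω] at this
    linarith
  have hψω : ψ ≠ 0 → ω = 1 := fun h => mul_right_cancel₀ h (by rw [hωψ, one_mul])
  have hκk : r ^ 2 ≤ k * k → κ ^ 2 * r ^ 2 ≤ κ ^ 2 * (k * k) := fun h => by gcongr
  have hκ0 : 0 ≤ κ ^ 2 * (k * k) := mul_nonneg (sq_nonneg _) (mul_self_nonneg _)
  rcases hp with rfl | rfl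
  -- Off the projection the term in `G` vanishes and `F = (1 - t)ψ`. What remains is the convex
  -- combination `F⁴ (κ² k²) + (1 - F⁴)`, with `κ² k² ≥ κ² r²` as soon as `ψ ≠ 0`.
  · have hφ : φ = 0 := by linarith
    subst hφ
    have hF₀ : 0 ≤ (1 - t) * ψ := mul_nonneg (by linarith) hψ₀
    have hF₁ : (1 - t) * ψ ≤ 1 := mul_le_one₀ (by linarith) hψ₀ hψ₁
    have hF4 : ((1 - t) * ψ) ^ 4 ≤ 1 := pow_le_one₀ hF₀ hF₁
    have hF4' : 0 ≤ ((1 - t) * ψ) ^ 4 := pow_nonneg hF₀ 4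
    simp only [mul_zero, add_zero, sub_zero]
    refine ⟨le_refl _, by linarith, ?_⟩
    rcases eq_or_ne ψ 0 with rfl | hψ
    · simpa using hc₁
    · have := hκk (hk' zero_lt_one (hψω hψ))
      nlinarith
  -- On the projection `F = 1`. If `φ = 1`, then `G = 1` and `g - δ` is available; if `φ < 1`, then
  -- `k² ≥ r²` and `G² ≤ 1` leave `κ² r² - δ`.
  · have hψ : ψ = 1 := by linarith
    subst hψ
    have hω : ω = 1 := by linarith
    have hG₀ : φ ≤ (1 - t) * φ + t * 1 := by nlinarith
    have hG₁ : (1 - t) * φ + t * 1 ≤ 1 := by nlinarith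
    set G := (1 - t) * φ + t * 1
    rw [show (1 - t) * 1 + t * 1 = (1 : ℝ) by ring, one_pow]
    refine ⟨by nlinarith, by norm_num, ?_⟩
    rcases hφ₁.eq_or_lt with rfl | hφ
    · have : G = 1 := le_antisymm hG₁ hG₀
      rw [this]
      linarith
    · have h1 := hκk (hk' hφ hω)
      have h2 : G * G ≤ 1 := by nlinarith
      have h3 : 0 ≤ G * (φ * φ) * G := by
        have : 0 ≤ G := hφ₀.trans hG₀
        positivity
      nlinarith [mul_nonneg hg h3]

end Localizer

/-! ### Commuting cutoffs and their bounds along the affine path -/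

section Localizer

variable {A : Type*} [CStarAlgebra A]

/-- The affine path from `x` to `y`. -/
def affinePath (x y : A) (t : ℝ) : A := (1 - t) • x + t • y

theorem isSelfAdjoint_affinePath {x y : A} (hx : IsSelfAdjoint x) (hy : IsSelfAdjoint y) (t : ℝ) :
    IsSelfAdjoint (affinePath x y t) :=
  ((IsSelfAdjoint.all _).smul hx).add ((IsSelfAdjoint.all _).smul hy)

theorem commute_affinePath {x y z : A} (hx : Commute z x) (hy : Commute z y) (t : ℝ) :
    Commute z (affinePath x y t) :=
  (hx.smul_right _).add_right (hy.smul_right _)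

/-- The part of the operators entering a localizer that commute with each other: `Φ`, `Ψ`, `Ω` are
successively larger cutoffs of an unbounded operator, `K` is its cutoff by `Ω` and `P` is a
projection with `Φ ≤ P ≤ Ψ`. -/
structure IsCutoff [PartialOrder A] (Φ Ψ Ω P K : A) (r : ℝ) : Prop where
  isSelfAdjoint : ∀ a ∈ ({Φ, Ψ, Ω, P, K} : Set A), IsSelfAdjoint a
  commute : ∀ a ∈ ({Φ, Ψ, Ω, P, K} : Set A), ∀ b ∈ ({Φ, Ψ, Ω, P, K} : Set A), a * b = b * a
  small_nonneg : 0 ≤ Φ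
  small_le_one : 0 ≤ 1 - Φ
  large_nonneg : 0 ≤ Ψ
  large_le_one : 0 ≤ 1 - Ψ
  proj_mul_proj : P * P = P
  proj_mul_small : P * Φ = Φ
  proj_mul_large : P * Ψ = P
  large_mul_small : Ψ * Φ = Φ
  cutoff_mul_large : Ω * Ψ = Ψ
  sq_bound : 0 ≤ (K * K - (r ^ 2) • (Ω * Ω)) * (1 - Φ)

namespace IsCutoff

variable [PartialOrder A] {Φ Ψ Ω P K : A} {r : ℝ}

theorem small_mul_proj (h : IsCutoff Φ Ψ Ω P K r) : Φ * P = Φ :=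
  (h.commute Φ (by simp) P (by simp)).trans h.proj_mul_small

theorem small_mul_large (h : IsCutoff Φ Ψ Ω P K r) : Φ * Ψ = Φ :=
  (h.commute Φ (by simp) Ψ (by simp)).trans h.large_mul_small

theorem large_mul_proj (h : IsCutoff Φ Ψ Ω P K r) : Ψ * P = P :=
  (h.commute Ψ (by simp) P (by simp)).trans h.proj_mul_large

theorem affinePath_mul (h : IsCutoff Φ Ψ Ω P K r) (t : ℝ) :
    affinePath Ψ P t * affinePath Φ P t = affinePath Φ P t := by
  simp only [affinePath, add_mul, mul_add, smul_mul_smul_comm, h.large_mul_small,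
    h.large_mul_proj, h.proj_mul_small, h.proj_mul_proj]
  module

theorem mul_affinePath (h : IsCutoff Φ Ψ Ω P K r) (t : ℝ) :
    affinePath Φ P t * affinePath Ψ P t = affinePath Φ P t := by
  simp only [affinePath, add_mul, mul_add, smul_mul_smul_comm, h.small_mul_large,
    h.proj_mul_large, h.small_mul_proj, h.proj_mul_proj]
  module

theorem proj_mul_affinePath (h : IsCutoff Φ Ψ Ω P K r) (t : ℝ) : P * affinePath Φ P t = affinePath Φ P t := by
  simp only [affinePath, mul_add, mul_smul_comm, h.proj_mul_small, h.proj_mul_proj]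

theorem affinePath_mul_proj (h : IsCutoff Φ Ψ Ω P K r) (t : ℝ) : affinePath Φ P t * P = affinePath Φ P t := by
  simp only [affinePath, add_mul, smul_mul_assoc, h.small_mul_proj, h.proj_mul_proj]

/-- All elements involved lie in one commuting family, so the inequalities are checked at each
character, where they are `localizer_pointwise_bound`. -/
theorem bounds [StarOrderedRing A] (h : IsCutoff Φ Ψ Ω P K r) {κ g δ c t : ℝ}
    (ht₀ : 0 ≤ t) (ht₁ : t ≤ 1) (hg : 0 ≤ g)
    (hδ : 0 ≤ δ) (hc₁ : c ≤ 1) (hc₂ : c ≤ g - δ) (hc₃ : c ≤ κ ^ 2 * r ^ 2 - δ) :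
    0 ≤ affinePath Φ P t * affinePath Φ P t - Φ * Φ ∧ 0 ≤ 1 - affinePath Ψ P t ^ 4 ∧
    0 ≤ g • (affinePath Φ P t * (Φ * Φ) * affinePath Φ P t) -
      δ • (affinePath Φ P t * affinePath Φ P t) +
      κ ^ 2 • (affinePath Ψ P t ^ 4 * (K * K)) + (1 - affinePath Ψ P t ^ 4) - c • 1 := by
  obtain ⟨Y, S, ev, hS, hev⟩ := exists_real_evaluations _ h.isSelfAdjoint h.commute
  let Φ' : S := ⟨Φ, hS (by simp)⟩
  let Ψ' : S := ⟨Ψ, hS (by simp)⟩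
  let Ω' : S := ⟨Ω, hS (by simp)⟩
  let P' : S := ⟨P, hS (by simp)⟩
  let K' : S := ⟨K, hS (by simp)⟩
  have key : ∀ y, _ := fun y => localizer_pointwise_bound (φ := ev y Φ') (ψ := ev y Ψ')
    (ω := ev y Ω') (p := ev y P') (k := ev y K') (r := r) (κ := κ) (g := g) (δ := δ) (c := c)
    (t := t) ((hev Φ').1 h.small_nonneg y)
    (by simpa using (hev (1 - Φ')).1 h.small_le_one y)
    ((hev Ψ').1 h.large_nonneg y)
    (by simpa using (hev (1 - Ψ')).1 h.large_le_one y)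
    (by rw [← map_mul]; exact congrArg (ev y) (Subtype.ext h.proj_mul_proj))
    (by rw [← map_mul]; exact congrArg (ev y) (Subtype.ext h.proj_mul_small))
    (by rw [← map_mul]; exact congrArg (ev y) (Subtype.ext h.proj_mul_large))
    (by rw [← map_mul]; exact congrArg (ev y) (Subtype.ext h.cutoff_mul_large))
    (by simpa using (hev ((K' * K' - (r ^ 2) • (Ω' * Ω')) * (1 - Φ'))).1 h.sq_bound y)
    ht₀ ht₁ hg hδ hc₁ hc₂ hc₃
  set G' : S := (1 - t) • Φ' + t • P' with hG'
  set F' : S := (1 - t) • Ψ' + t • P' with hF'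
  refine ⟨(hev (G' * G' - Φ' * Φ')).2 fun y => ?_, (hev (1 - F' ^ 4)).2 fun y => ?_,
    (hev (g • (G' * (Φ' * Φ') * G') - δ • (G' * G') + κ ^ 2 • (F' ^ 4 * (K' * K')) +
      (1 - F' ^ 4) - c • 1)).2 fun y => ?_⟩
  · simpa [hG'] using (key y).1
  · simpa [hF'] using (key y).2.1
  · simpa [hG', hF'] using (key y).2.2

end IsCutoff

/-- A lower bound for the square of an invertible selfadjoint element. -/
theorem inv_norm_inverse_sq_le [PartialOrder A] [StarOrderedRing A] [Nontrivial A] {H : A}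
    (hH : IsSelfAdjoint H) (hu : IsUnit H) :
    0 ≤ H * H - (‖Ring.inverse H‖⁻¹ ^ 2) • (1 : A) := by
  set J := Ring.inverse H
  have h1 : H * J = 1 := Ring.mul_inverse_cancel _ hu
  have h2 : J * H = 1 := Ring.inverse_mul_cancel _ hu
  have hJ : IsSelfAdjoint J := by
    have h3 : star J * H = 1 := by rw [← hH.star_eq, ← star_mul, h1, star_one]
    exact left_inv_eq_right_inv h3 h1
  have hn : 0 < ‖J‖ := norm_pos_iff.2 fun h => by simp [h] at h1
  -- Conjugating `J² ≤ ‖J‖²` by `H` gives `1 ≤ ‖J‖² H²`.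
  have h4 := sub_nonneg.2 (CStarAlgebra.star_mul_le_algebraMap_norm_sq (a := J))
  have h5 := hH.conjugate_nonneg h4
  rw [hJ.star_eq, Algebra.algebraMap_eq_smul_one, mul_sub, sub_mul, mul_smul_comm, smul_mul_assoc,
    mul_one, show H * (J * J) * H = (H * J) * (J * H) by simp only [mul_assoc], h1, h2,
    mul_one] at h5
  have h6 := smul_nonneg (by positivity : 0 ≤ ‖J‖⁻¹ ^ 2) h5
  rwa [smul_sub, smul_smul, ← mul_pow, inv_mul_cancel₀ hn.ne', one_pow, one_smul] at h6

end Localizer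

/-! ### The square of a localizer and its lower bound -/

section Localizer

variable {A : Type*} [CStarAlgebra A]

/-- The square of a localizer. -/
theorem localizer_mul_self {γ H G F K S : A} {κ : ℝ} (hγγ : γ * γ = 1) (hγH : γ * H = H * γ)
    (hγG : γ * G = G * γ) (hγF : γ * F = F * γ) (hγK : γ * K = -(K * γ)) (hγS : γ * S = S * γ)
    (hFG : F * G = G) (hGF : G * F = G) (hFK : F * K = K * F) (hGK : G * K = K * G)
    (hFS : F * S = S * F) (hKS : K * S = S * K) (hGS : G * S = 0) (hSG : S * G = 0)
    (hSS : S * S = 1 - F ^ 4) :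
    (G * γ * H * G + κ • (F * K * F) - S * γ) * (G * γ * H * G + κ • (F * K * F) - S * γ) =
      G * (H * (G * G) * H) * G + κ • (G * (γ * (H * K - K * H)) * G) +
        κ ^ 2 • (F ^ 4 * (K * K)) + (1 - F ^ 4) := by
  set a := G * γ * H * G
  set b := F * K * F
  have hbG : b * G = K * G := by
    simp only [b]
    rw [mul_assoc, hFG, hFK, mul_assoc, hFG]
  have hGb : G * b = G * K := by
    simp only [b]
    rw [← mul_assoc, ← mul_assoc, hGF, mul_assoc, ← hFK, ← mul_assoc, hGF]
  have haa : a * a = G * (H * (G * G) * H) * G := by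
    simp only [a]
    calc G * γ * H * G * (G * γ * H * G) = G * (γ * H) * G * (G * γ) * H * G := by
          simp only [mul_assoc]
      _ = G * H * (γ * G) * (γ * G) * H * G := by rw [hγH, ← hγG]; simp only [mul_assoc]
      _ = G * H * G * (γ * γ) * G * H * G := by
          nth_rw 1 [hγG]
          simp only [mul_assoc]
      _ = _ := by
          rw [hγγ]
          simp only [mul_assoc, one_mul]
  have hab : a * b + b * a = G * (γ * (H * K - K * H)) * G := by
    have h1 : a * b = G * (γ * (H * K)) * G := by
      simp only [a]
      rw [mul_assoc _ G b, hGb, hGK]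
      simp only [mul_assoc]
    have h2 : b * a = G * (-(γ * (K * H))) * G := by
      have : b * a = b * G * (γ * H * G) := by simp only [a, mul_assoc]
      rw [this, hbG, ← hGK]
      calc G * K * (γ * H * G) = G * (K * γ) * H * G := by simp only [mul_assoc]
        _ = G * (-(γ * K)) * H * G := by rw [hγK, neg_neg]
        _ = _ := by simp only [mul_assoc, neg_mul, mul_neg]
    rw [h1, h2, mul_sub, sub_eq_add_neg, mul_add, add_mul]
  have hbb : b * b = F ^ 4 * (K * K) := by
    have : b = F ^ 2 * K := by
      simp only [b]
      rw [mul_assoc, ← hFK, ← mul_assoc, sq]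
    have hc : Commute (F ^ 2) K := Commute.pow_left hFK 2
    rw [this, mul_assoc, ← mul_assoc K, ← hc.eq, show F ^ 4 = F ^ 2 * F ^ 2 by rw [← pow_add]]
    simp only [mul_assoc]
  have hac : a * (S * γ) = 0 := by
    simp only [a, mul_assoc]
    rw [← mul_assoc G S, hGS]
    simp
  have hca : S * γ * a = 0 := by
    rw [← hγS]
    simp only [a, mul_assoc]
    rw [← mul_assoc S G, hSG]
    simp
  -- `F K F` is odd and commutes with `S`, hence it anticommutes with `S γ`.
  have hbc : b * (S * γ) + S * γ * b = 0 := by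
    have hSb : S * b = b * S := by
      have h1 : Commute S F := hFS.symm
      have h2 : Commute S K := hKS.symm
      exact (h1.mul_right h2).mul_right h1
    have hγb : γ * b = -(b * γ) := by
      simp only [b]
      rw [← mul_assoc, ← mul_assoc, hγF, mul_assoc F, hγK]
      simp only [mul_neg, neg_mul, mul_assoc, hγF]
    rw [mul_assoc S, hγb, mul_neg, ← mul_assoc, ← mul_assoc, hSb, add_neg_cancel]
  have hcc : S * γ * (S * γ) = 1 - F ^ 4 := by
    rw [← mul_assoc, mul_assoc S γ S, hγS, ← mul_assoc, mul_assoc, hγγ, mul_one, hSS]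
  have hexp : (a + κ • b - S * γ) * (a + κ • b - S * γ) = a * a + κ • (a * b + b * a) +
      κ ^ 2 • (b * b) + S * γ * (S * γ) - (a * (S * γ) + S * γ * a) -
      κ • (b * (S * γ) + S * γ * b) := by
    simp only [sub_mul, mul_sub, add_mul, mul_add, smul_mul_assoc, mul_smul_comm]
    module
  rw [hexp, haa, hab, hbb, hcc, hac, hca, hbc]
  simp

variable [PartialOrder A] [StarOrderedRing A] {γ H Φ Ψ Ω P K : A} {r : ℝ}

/-- The path of localizers that joins `Φ γ H Φ + κ Ψ K Ψ - (1 - Ψ⁴)^{1/2} γ` to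
`P γ H P + κ P K P - (1 - P) γ`. -/
def localizerPath (γ H Φ Ψ P K : A) (κ t : ℝ) : A :=
  affinePath Φ P t * γ * H * affinePath Φ P t + κ • (affinePath Ψ P t * K * affinePath Ψ P t) -
    cfc Real.sqrt (1 - affinePath Ψ P t ^ 4) * γ

/-- The square of the localizer is bounded below by a positive scalar `c`. It is split into three
positive elements conjugated by `G` and one combination of commuting cutoffs, handled by
`IsCutoff.bounds`. -/
theorem IsCutoff.isUnit_localizerPath (h : IsCutoff Φ Ψ Ω P K r)
    (hγ : IsSelfAdjoint γ) (hγγ : γ * γ = 1) (hH : IsSelfAdjoint H) (hHu : IsUnit H)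
    (hγH : γ * H = H * γ) (hγΦ : γ * Φ = Φ * γ) (hγΨ : γ * Ψ = Ψ * γ) (hγP : γ * P = P * γ)
    (hγK : γ * K = -(K * γ)) {d : A} (hd : P * (K * H - H * K) * P = P * d * P)
    {ε κ : ℝ} (hκ : 0 < κ) (hε : ‖Φ * H - H * Φ‖ ≤ ε)
    (hδ : κ * ‖d‖ + 2 * ε * ‖H‖ < min (‖Ring.inverse H‖⁻¹ ^ 2) (κ ^ 2 * r ^ 2))
    {t : ℝ} (ht₀ : 0 ≤ t) (ht₁ : t ≤ 1) : IsUnit (localizerPath γ H Φ Ψ P K κ t) := by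
  rcases subsingleton_or_nontrivial A with hA | hA
  · exact isUnit_of_subsingleton _
  have hΦsa : IsSelfAdjoint Φ := h.isSelfAdjoint Φ (by simp)
  have hΨsa : IsSelfAdjoint Ψ := h.isSelfAdjoint Ψ (by simp)
  have hPsa : IsSelfAdjoint P := h.isSelfAdjoint P (by simp)
  have hKsa : IsSelfAdjoint K := h.isSelfAdjoint K (by simp)
  set δ := κ * ‖d‖ + 2 * ε * ‖H‖ with hδ_def
  set g := ‖Ring.inverse H‖⁻¹ ^ 2
  have hε0 : 0 ≤ ε := (norm_nonneg _).trans hε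
  have hδ0 : 0 ≤ δ := by positivity
  obtain ⟨hδ₁, hδ₂⟩ := lt_min_iff.1 hδ
  set c := min 1 (min (g - δ) (κ ^ 2 * r ^ 2 - δ)) with hc
  have hc0 : 0 < c := lt_min one_pos (lt_min (by linarith) (by linarith))
  obtain ⟨b1, b2, b3⟩ := h.bounds (κ := κ) (g := g) (δ := δ) (c := c) ht₀ ht₁ (by positivity) hδ0
    (min_le_left _ _) ((min_le_right _ _).trans (min_le_left _ _))
    ((min_le_right _ _).trans (min_le_right _ _))
  have hGsa := isSelfAdjoint_affinePath hΦsa hPsa t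
  have hFsa := isSelfAdjoint_affinePath hΨsa hPsa t
  have hGF := h.mul_affinePath t
  have hFG := h.affinePath_mul t
  have hPG := h.proj_mul_affinePath t
  have hGP := h.affinePath_mul_proj t
  have hcK : ∀ a ∈ ({Φ, Ψ, Ω, P, K} : Set A), Commute K a := fun a ha =>
    h.commute K (by simp) a ha
  have hKG : Commute K (affinePath Φ P t) :=
    commute_affinePath (hcK Φ (by simp)) (hcK P (by simp)) t
  have hKF : Commute K (affinePath Ψ P t) :=
    commute_affinePath (hcK Ψ (by simp)) (hcK P (by simp)) t
  have hγG : Commute γ (affinePath Φ P t) := commute_affinePath hγΦ hγP t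
  have hγF : Commute γ (affinePath Ψ P t) := commute_affinePath hγΨ hγP t
  unfold localizerPath
  set G := affinePath Φ P t
  set F := affinePath Ψ P t
  set S := cfc Real.sqrt (1 - F ^ 4) with hS
  have hSsa : IsSelfAdjoint S := cfc_predicate _ _
  have hSS : S * S = 1 - F ^ 4 := by
    have hsa : IsSelfAdjoint (1 - F ^ 4) := .of_nonneg b2
    rw [hS, ← cfc_mul _ _ _ (by fun_prop) (by fun_prop)]
    conv_rhs => rw [← cfc_id' ℝ (1 - F ^ 4)]
    refine cfc_congr fun x hx => ?_
    exact Real.mul_self_sqrt (spectrum_nonneg_of_nonneg b2 hx)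
  have hScomm : ∀ z, Commute F z → Commute S z := fun z hz =>
    ((Commute.one_left z).sub_left (hz.pow_left 4)).cfc_real _
  have hGS0 : (1 - F ^ 4) * G = 0 := by
    rw [sub_mul, one_mul, show F ^ 4 = F * F * F * F by noncomm_ring]
    simp only [mul_assoc, hFG, sub_self]
  -- `(S G)* (S G) = G S² G = G (1 - F⁴) G`, which vanishes because `F G = G`.
  have hSG : S * G = 0 := by
    rw [← CStarRing.star_mul_self_eq_zero_iff, star_mul, hSsa.star_eq, mul_assoc, ← mul_assoc S,
      hSS, hGS0, mul_zero]
  have hGS : G * S = 0 := by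
    have := congrArg star hSG
    rwa [star_mul, hGsa.star_eq, hSsa.star_eq, star_zero] at this
  have hLL := localizer_mul_self (κ := κ) hγγ hγH hγG.eq hγF.eq hγK (hScomm γ hγF.symm).symm.eq
    hFG hGF hKF.symm.eq hKG.symm.eq (hScomm F (.refl F)).symm.eq (hScomm K hKF.symm).symm.eq
    hGS hSG hSS
  have hΦ1 : ‖Φ‖ ≤ 1 :=
    (CStarAlgebra.norm_le_one_iff_of_nonneg Φ h.small_nonneg).2 (sub_nonneg.1 h.small_le_one)
  have hγ1 : ‖γ‖ ≤ 1 :=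
    (CStarRing.norm_of_mem_unitary (Unitary.mem_iff.2 (by simp [hγ.star_eq, hγγ]))).le
  have hP1 : ‖P‖ ≤ 1 := by
    have h1 : ‖P‖ * ‖P‖ = ‖P‖ := by
      rw [← CStarRing.norm_star_mul_self, hPsa.star_eq, h.proj_mul_proj]
    by_contra hlt
    nlinarith
  -- `E` collects the errors: from exchanging `Φ` with `H`, and from the commutator of `H` with `K`.
  -- Compressing the latter by `P` is free, since `G P = P G = G`, and it turns `[K, H]` into the
  -- bounded `d`.
  set E := (H * (Φ * Φ) * H - Φ * (H * H) * Φ) + κ • (P * (γ * (H * K - K * H)) * P) with hE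
  -- The commutator of the even `H` with the odd `K` is skew-adjoint and anticommutes with `γ`, so
  -- `γ [H, K]` is selfadjoint.
  have hEsa : IsSelfAdjoint E := by
    refine IsSelfAdjoint.add (.sub ?_ ?_) (.smul (.all κ) ?_)
    · simp [IsSelfAdjoint, star_mul, hH.star_eq, hΦsa.star_eq, mul_assoc]
    · simp [IsSelfAdjoint, star_mul, hH.star_eq, hΦsa.star_eq, mul_assoc]
    · have e1 : (H * K - K * H) * γ = -(γ * (H * K - K * H)) := by
        have hKγ : K * γ = -(γ * K) := by rw [hγK, neg_neg]
        rw [sub_mul, mul_assoc, mul_assoc, ← hγH, ← mul_assoc K, hKγ, mul_neg, neg_mul,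
          ← mul_assoc H, ← hγH, mul_sub]
        simp only [mul_assoc]
        abel
      simp only [IsSelfAdjoint, star_mul, star_sub, hH.star_eq, hKsa.star_eq, hPsa.star_eq,
        hγ.star_eq]
      rw [show K * H - H * K = -(H * K - K * H) by abel, neg_mul, e1, neg_neg]
      simp only [mul_assoc]
  have hEn : ‖E‖ ≤ δ := by
    have e1 : H * (Φ * Φ) * H - Φ * (H * H) * Φ =
        -((Φ * H - H * Φ) * (Φ * H)) + Φ * H * (Φ * H - H * Φ) := by noncomm_ring
    have e2 : P * (γ * (H * K - K * H)) * P = -(γ * (P * d * P)) := by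
      rw [← hd, ← mul_assoc, ← hγP]
      noncomm_ring
    have n1 : ‖Φ * H‖ ≤ ‖H‖ := (norm_mul_le _ _).trans (mul_le_of_le_one_left (norm_nonneg _) hΦ1)
    have n2 : ‖γ * (P * d * P)‖ ≤ ‖d‖ := by
      calc _ ≤ ‖γ‖ * (‖P‖ * ‖d‖ * ‖P‖) := (norm_mul_le _ _).trans (by gcongr; exact norm_mul₃_le)
        _ ≤ 1 * (1 * ‖d‖ * 1) := by gcongr
        _ = ‖d‖ := by ring
    rw [hE, e1, e2]
    calc _ ≤ (‖(Φ * H - H * Φ) * (Φ * H)‖ + ‖Φ * H * (Φ * H - H * Φ)‖) +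
          κ * ‖γ * (P * d * P)‖ := by
            refine (norm_add_le _ _).trans (add_le_add ((norm_add_le _ _).trans ?_) ?_)
            · rw [norm_neg]
            · rw [norm_smul, norm_neg, Real.norm_of_nonneg hκ.le]
      _ ≤ (ε * ‖H‖ + ‖H‖ * ε) + κ * ‖d‖ := by
            gcongr
            · exact (norm_mul_le _ _).trans (by gcongr)
            · exact (norm_mul_le _ _).trans (by gcongr)
      _ = δ := by rw [hδ_def]; ring
  have hE0 : 0 ≤ E + δ • (1 : A) := by
    have h1 := hEsa.neg_algebraMap_norm_le_self
    have h2 : (0 : A) ≤ (δ - ‖E‖) • 1 := smul_nonneg (sub_nonneg.2 hEn) zero_le_one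
    rw [Algebra.algebraMap_eq_smul_one, neg_le_iff_add_nonneg] at h1
    have h3 := add_nonneg h1 h2
    rw [sub_smul] at h3
    convert h3 using 1
    abel
  have p1 := hGsa.conjugate_nonneg (hH.conjugate_nonneg b1)
  have p2 := hGsa.conjugate_nonneg hE0
  have p3 := hGsa.conjugate_nonneg (hΦsa.conjugate_nonneg (inv_norm_inverse_sq_le hH hHu))
  have hGE : G * (γ * (H * K - K * H)) * G = G * (P * (γ * (H * K - K * H)) * P) * G := by
    generalize γ * (H * K - K * H) = Z
    calc G * Z * G = G * P * Z * (P * G) := by rw [hGP, hPG]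
      _ = _ := by simp only [mul_assoc]
  have hfin : (G * γ * H * G + κ • (F * K * F) - S * γ) * (G * γ * H * G + κ • (F * K * F) - S * γ)
      - c • 1 = G * (H * (G * G - Φ * Φ) * H) * G + G * (E + δ • (1 : A)) * G +
        G * (Φ * (H * H - g • (1 : A)) * Φ) * G + (g • (G * (Φ * Φ) * G) - δ • (G * G) +
        κ ^ 2 • (F ^ 4 * (K * K)) + (1 - F ^ 4) - c • 1) := by
    rw [hLL, hGE, hE]
    simp only [mul_add, add_mul, mul_sub, sub_mul, mul_smul_comm, smul_mul_assoc, mul_one,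
      smul_sub, mul_assoc]
    abel
  have hpos : 0 ≤ (G * γ * H * G + κ • (F * K * F) - S * γ) *
      (G * γ * H * G + κ • (F * K * F) - S * γ) - c • 1 := by
    rw [hfin]
    exact add_nonneg (add_nonneg (add_nonneg p1 p2) p3) b3
  have hunit : IsUnit ((G * γ * H * G + κ • (F * K * F) - S * γ) ^ 2) := by
    rw [sq]
    refine CStarAlgebra.isUnit_of_le (c • (1 : A)) (sub_nonneg.1 hpos) ?_
    exact IsStrictlyPositive.smul hc0 isStrictlyPositive_one
  -- An element whose square is invertible is itself invertible.
  exact (isUnit_pow_iff two_ne_zero).1 hunit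

end Localizer

/-! ### Paths of cycles -/

section Paths

variable {L : Type*} [CStarAlgebra L] (I : ClosedStarIdeal L)

/-- A selfadjoint invertible perturbation `y` of the symmetry `-γ` by an element of the ideal gives
the cycle `(-γ, y)`. -/
theorem isCycle_neg_symmetry {γ y : L} (hγ : IsSelfAdjoint γ) (hγγ : γ * γ = 1)
    (hy : IsSelfAdjoint y) (hyu : IsUnit y) (hyI : y + γ ∈ I.toSubmodule) :
    IsCycle I (-γ) y := by
  have hmem : ((-γ, y) : L × L) ∈ doubleAlg L I := by
    change -γ - y ∈ I.toSubmodule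
    have := I.toSubmodule.neg_mem hyI
    rwa [neg_add_rev, ← sub_eq_add_neg] at this
  refine ⟨hmem, Subtype.ext (Prod.ext ?_ hy.star_eq), ?_⟩
  · change star (-γ) = -γ
    rw [star_neg, hγ.star_eq]
  obtain ⟨z, hyz, hzy⟩ := isUnit_iff_exists.1 hyu
  -- The inverse stays in the double: with `z = y⁻¹`, one has `z ((y + γ) γ) = γ + z`.
  have hz : ((-γ, z) : L × L) ∈ doubleAlg L I := by
    change -γ - z ∈ I.toSubmodule
    have h : -γ - z = -(z * ((y + γ) * γ)) := by
      rw [add_mul, hγγ, mul_add, ← mul_assoc, hzy]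
      simp only [one_mul, mul_one, neg_add_rev]
      abel
    rw [h]
    exact I.toSubmodule.neg_mem (I.mul_mem_left _ (I.mul_mem_right _ hyI))
  refine isUnit_iff_exists.2 ⟨⟨(-γ, z), hz⟩, Subtype.ext (Prod.ext ?_ hyz),
    Subtype.ext (Prod.ext ?_ hzy)⟩ <;>
  · change -γ * -γ = 1
    rw [neg_mul_neg, hγγ]

/-- Homotopic cycles have the same class. -/
theorem cls_eq_of_path {x : L} {f : ℝ → L} (hf : Continuous f)
    (h : ∀ t ∈ Set.Icc (0 : ℝ) 1, IsCycle I x (f t)) :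
    (h 0 (by simp)).cls = (h 1 (by simp)).cls := by
  have : Subsingleton (CStarMatrix (Fin 0) (Fin 0) L) :=
    inferInstanceAs (Subsingleton (Matrix (Fin 0) (Fin 0) L))
  -- The path already lives in `1 × 1` matrices, so the stabilizing summands are empty.
  let G : SaInv L 0 := ⟨0, Subsingleton.elim _ _, isUnit_of_subsingleton _⟩
  refine Quot.sound ⟨1, 0, 0, rfl, rfl, G, G, ?_⟩
  refine ⟨⟨⟨fun t => SaInv.sum rfl (SaInv.single ⟨(x, f t), (h t t.2).mem⟩ (h t t.2).isSelfAdjoint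
    (h t t.2).isUnit) (G.map (diag L I)), ?_⟩, rfl, rfl⟩⟩
  refine Continuous.subtype_mk ?_ _
  have hc : Continuous fun t : unitInterval => (⟨(x, f t), (h t t.2).mem⟩ : doubleAlg L I) :=
    Continuous.subtype_mk (continuous_const.prodMk (hf.comp continuous_subtype_val)) _
  have hm : Continuous fun t : unitInterval =>
      (fun _ _ => ⟨(x, f t), (h t t.2).mem⟩ : Matrix (Fin 1) (Fin 1) (doubleAlg L I)) :=
    continuous_matrix fun _ _ => hc
  exact (hm.matrix_fromBlocks continuous_const continuous_const continuous_const).matrix_reindex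
    _ _

end Paths

/-! ### The localizer path: continuity, selfadjointness, ideal membership and endpoints -/

section Localizer

variable {A : Type*} [CStarAlgebra A] {γ H Φ Ψ Ω P K : A} {r : ℝ}

theorem continuous_affinePath (x y : A) : Continuous (affinePath x y) := by
  unfold affinePath
  fun_prop

theorem isSelfAdjoint_one_sub_affinePath_pow {x y : A} (hx : IsSelfAdjoint x)
    (hy : IsSelfAdjoint y) (t : ℝ) : IsSelfAdjoint (1 - affinePath x y t ^ 4) :=
  (IsSelfAdjoint.one A).sub ((isSelfAdjoint_affinePath hx hy t).pow 4)

theorem continuous_localizerPath (hΨ : IsSelfAdjoint Ψ) (hP : IsSelfAdjoint P) (κ : ℝ) :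
    Continuous (localizerPath γ H Φ Ψ P K κ) := by
  have h1 := continuous_affinePath Φ P
  have h2 := continuous_affinePath Ψ P
  have h3 : Continuous fun t => cfc Real.sqrt (1 - affinePath Ψ P t ^ 4) :=
    Continuous.cfc_of_mem_nhdsSet Real.sqrt Filter.univ_mem (by fun_prop)
      (isSelfAdjoint_one_sub_affinePath_pow hΨ hP) Real.continuous_sqrt.continuousOn
  unfold localizerPath
  fun_prop

theorem isSelfAdjoint_localizerPath (hγ : IsSelfAdjoint γ) (hH : IsSelfAdjoint H)
    (hΦ : IsSelfAdjoint Φ) (hΨ : IsSelfAdjoint Ψ) (hP : IsSelfAdjoint P) (hK : IsSelfAdjoint K)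
    (hγH : γ * H = H * γ) (hγΨ : γ * Ψ = Ψ * γ) (hγP : γ * P = P * γ) (κ t : ℝ) :
    IsSelfAdjoint (localizerPath γ H Φ Ψ P K κ t) := by
  have hG := isSelfAdjoint_affinePath hΦ hP t
  have hF := isSelfAdjoint_affinePath hΨ hP t
  have hγF : Commute γ (affinePath Ψ P t) := commute_affinePath hγΨ hγP t
  unfold localizerPath
  refine (IsSelfAdjoint.add ?_ (.smul (.all κ) ?_)).sub ?_
  · have h1 : IsSelfAdjoint (γ * H) := by
      rw [IsSelfAdjoint, star_mul, hγ.star_eq, hH.star_eq, hγH]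
    have := h1.conjugate_self hG
    simpa only [mul_assoc] using this
  · exact hK.conjugate_self hF
  · have h1 : Commute (cfc Real.sqrt (1 - affinePath Ψ P t ^ 4)) γ :=
      ((Commute.one_left γ).sub_left (hγF.symm.pow_left 4)).cfc_real _
    have h2 : IsSelfAdjoint (cfc Real.sqrt (1 - affinePath Ψ P t ^ 4)) := cfc_predicate _ _
    rw [IsSelfAdjoint, star_mul, hγ.star_eq, h2.star_eq, h1.eq]

/-- With `S` the square root, `(1 - S)(1 + S) = a` and `1 + S ≥ 1` is invertible, so `1 - S = a (1 +
S)⁻¹`. -/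
theorem one_sub_cfc_sqrt_mem [PartialOrder A] [StarOrderedRing A] (I : ClosedStarIdeal A) {a : A}
    (ha : a ∈ I.toSubmodule) (h1 : 0 ≤ 1 - a) : 1 - cfc Real.sqrt (1 - a) ∈ I.toSubmodule := by
  set S := cfc Real.sqrt (1 - a) with hS
  have hSS : S * S = 1 - a := by
    have hsa : IsSelfAdjoint (1 - a) := .of_nonneg h1
    rw [hS, ← cfc_mul _ _ _ (by fun_prop) (by fun_prop)]
    conv_rhs => rw [← cfc_id' ℝ (1 - a)]
    exact cfc_congr fun x hx => Real.mul_self_sqrt (spectrum_nonneg_of_nonneg h1 hx)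
  have hS0 : 0 ≤ S := cfc_nonneg fun x _ => Real.sqrt_nonneg x
  have hu : IsUnit (1 + S) := by
    refine CStarAlgebra.isUnit_of_le (1 : A) (le_add_of_nonneg_right hS0) isStrictlyPositive_one
  obtain ⟨z, hz, -⟩ := isUnit_iff_exists.1 hu
  have h2 : 1 - S = a * z := by
    have h3 : (1 - S) * (1 + S) = a := by
      rw [mul_add, sub_mul, sub_mul, hSS]
      simp
    rw [← h3, mul_assoc, hz, mul_one]
  rw [h2]
  exact I.mul_mem_right _ ha

theorem localizerPath_add_mem [PartialOrder A] [StarOrderedRing A] (I : ClosedStarIdeal A)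
    (hΦ : Φ ∈ I.toSubmodule) (hΨ : Ψ ∈ I.toSubmodule) (hP : P ∈ I.toSubmodule) (κ : ℝ) {t : ℝ}
    (h : 0 ≤ 1 - affinePath Ψ P t ^ 4) :
    localizerPath γ H Φ Ψ P K κ t + γ ∈ I.toSubmodule := by
  have hmem : ∀ x ∈ I.toSubmodule, ∀ s : ℝ, s • x ∈ I.toSubmodule := fun x hx s =>
    I.toSubmodule.smul_mem (s : ℂ) hx
  have hG : affinePath Φ P t ∈ I.toSubmodule := add_mem (hmem _ hΦ _) (hmem _ hP _)
  have hF : affinePath Ψ P t ∈ I.toSubmodule := add_mem (hmem _ hΨ _) (hmem _ hP _)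
  have hF4 : affinePath Ψ P t ^ 4 ∈ I.toSubmodule := by
    rw [pow_succ]
    exact I.mul_mem_left _ hF
  have e : localizerPath γ H Φ Ψ P K κ t + γ = affinePath Φ P t * γ * H * affinePath Φ P t +
      κ • (affinePath Ψ P t * K * affinePath Ψ P t) +
        (1 - cfc Real.sqrt (1 - affinePath Ψ P t ^ 4)) * γ := by
    rw [localizerPath, sub_mul, one_mul]
    abel
  rw [e]
  exact add_mem (add_mem (I.mul_mem_left _ hG) (hmem _ (I.mul_mem_left _ hF) _))
    (I.mul_mem_right _ (one_sub_cfc_sqrt_mem I hF4 h))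

theorem localizerPath_zero (κ : ℝ) : localizerPath γ H Φ Ψ P K κ 0 =
    Φ * γ * H * Φ + κ • (Ψ * K * Ψ) - cfc Real.sqrt (1 - Ψ ^ 4) * γ := by
  simp [localizerPath, affinePath]

/-- At `t = 1` both affine paths equal the projection `P`; then `P⁴ = P`, and `1 - P` is its own
square root. -/
theorem localizerPath_one (hP : IsSelfAdjoint P) (hPP : P * P = P) (hγP : γ * P = P * γ) (κ : ℝ) :
    localizerPath γ H Φ Ψ P K κ 1 = γ * (P * H * P - (1 - P)) + κ • (P * K * P) := by
  have hi : IsIdempotentElem (1 - P) := IsIdempotentElem.one_sub hPP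
  have h4 : P ^ 4 = P := IsIdempotentElem.pow_succ_eq (n := 3) hPP
  have hS : cfc Real.sqrt (1 - P) = 1 - P := by
    have hsa : IsSelfAdjoint (1 - P) := (IsSelfAdjoint.one A).sub hP
    conv_rhs => rw [← cfc_id' ℝ (1 - P)]
    refine cfc_congr fun x hx => ?_
    rcases hi.spectrum_subset ℝ hx with rfl | rfl <;> simp
  have e : ∀ x : A, affinePath x P 1 = P := fun x => by simp [affinePath]
  rw [localizerPath, e, e, h4, hS, mul_sub γ, mul_sub γ, sub_mul, ← hγP]
  simp only [mul_assoc, mul_one, one_mul]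
  abel

end Localizer

/-! ### Cutoffs of an odd operator -/

/-- Conjugation by `γ` is a continuous `*`-homomorphism that sends `a` to `a*`, so it intertwines
the functional calculi of `a` and `a*`. -/
theorem conj_symmetry_cfc {A : Type*} [CStarAlgebra A] {γ a : A} (hγ : IsSelfAdjoint γ)
    (hγγ : γ * γ = 1) (ha : IsStarNormal a) (h : γ * a = star a * γ) {f : ℂ → ℂ}
    (hf : ContinuousOn f (spectrum ℂ a)) (hf' : ContinuousOn f (star '' spectrum ℂ a)) :
    γ * cfc f a = cfc (fun z => f (star z)) a * γ := by
  let F : A →⋆ₐ[ℂ] A :=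
    { toFun := fun x => γ * x * γ
      map_one' := by rw [mul_one, hγγ]
      map_mul' := fun x y => by
        calc γ * (x * y) * γ = γ * x * 1 * y * γ := by simp only [mul_assoc, mul_one]
          _ = _ := by rw [← hγγ]; simp only [mul_assoc]
      map_zero' := by simp
      map_add' := fun x y => by rw [mul_add, add_mul]
      commutes' := fun c => by
        rw [Algebra.algebraMap_eq_smul_one, mul_smul_comm, mul_one, smul_mul_assoc, hγγ]
      map_star' := fun x => by rw [star_mul, star_mul, hγ.star_eq, mul_assoc] }
  have hFa : F a = star a := by
    change γ * a * γ = star a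
    rw [h, mul_assoc, hγγ, mul_one]
  have hFc : Continuous F := (continuous_const.mul continuous_id).mul continuous_const
  have h1 := StarAlgHomClass.map_cfc F f a hf hFc ha (hFa ▸ ha.star)
  rw [hFa, ← cfc_comp_star f a hf'] at h1
  rw [← h1]
  change _ = γ * cfc f a * γ * γ
  rw [mul_assoc _ γ γ, hγγ, mul_one]

theorem one_sub_nonneg_of_norm_le_one {A : Type*} [CStarAlgebra A] [PartialOrder A]
    [StarOrderedRing A] {a : A} (h : 0 ≤ a) (hn : ‖a‖ ≤ 1) : 0 ≤ 1 - a :=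
  sub_nonneg.2 <| (CStarAlgebra.norm_le_one_iff_of_nonneg a h).1 hn

section

variable {B X : Type*} [NonUnitalCStarAlgebra B] [PartialOrder B] [StarOrderedRing B]
  [NormedAddCommGroup X] [NormedSpace ℂ X] [SMul B X] [CStarModule B X] [CompleteSpace X]

namespace SaRegular

theorem IsComp.mul_right {D : SaRegular B X} {T S : adjointable B X} (h : D.IsComp T S)
    (V : adjointable B X) : D.IsComp (T * V) (S * V) := fun x => h (V.1 x)

theorem IsLipschitz.isDeriv_d {D : SaRegular B X} {T : adjointable B X} (h : D.IsLipschitz T) :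
    D.IsDeriv T h.d := h.choose_spec

/-- Compression of the commutator `[D, T]` by a projection that commutes with `D`. -/
theorem compression_commutator {D : SaRegular B X} {T δ P K : adjointable B X}
    (hT : D.IsDeriv T δ) (hP : IsSelfAdjoint P) (hK : IsSelfAdjoint K)
    (h : D.IsComp P (K * P)) : P * (K * T - T * K) * P = P * δ * P := by
  refine adjointable_ext fun x y => ?_
  obtain ⟨hx, ex⟩ := h x
  obtain ⟨hy, ey⟩ := h y
  obtain ⟨hz, ez⟩ := hT ⟨P.1 y, hy⟩
  have hin : ∀ V : adjointable B X, IsSelfAdjoint V → ∀ v w : X,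
      inner B v (V.1 w) = inner B (V.1 v) w := fun V hV v w => by
    rw [← inner_star_right, hV.star_eq]
  change inner B x (P.1 (K.1 (T.1 (P.1 y)) - T.1 (K.1 (P.1 y)))) = inner B x (P.1 (δ.1 (P.1 y)))
  change D.op ⟨P.1 x, hx⟩ = K.1 (P.1 x) at ex
  change D.op ⟨P.1 y, hy⟩ = K.1 (P.1 y) at ey
  rw [hin P hP, hin P hP, ← ez, ey, CStarModule.inner_sub_right, CStarModule.inner_sub_right,
    hin K hK, ← ex]
  congr 1
  exact D.symm ⟨P.1 x, hx⟩ ⟨T.1 (P.1 y), hz⟩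

end SaRegular

namespace KasparovModule

variable (M : KasparovModule B X)

/-- Oddness gives `γ (D + i)⁻¹ = -(D - i)⁻¹ γ`, and `(D - i)⁻¹` is the adjoint of the resolvent. -/
theorem symmetry_mul_cayley : M.γ * M.D.cayley = star M.D.cayley * M.γ := by
  have h : star M.D.resolvent * M.γ = -(M.γ * M.D.resolvent) := by
    refine Subtype.ext <| ContinuousLinearMap.ext fun y => ?_
    have h1 := M.D.isResolventAt_funCalc (c := -1) (by norm_num)
    have h2 : star M.D.resolvent = M.D.funCalc fun x => ((x : ℂ) + (-1 : ℝ) * Complex.I)⁻¹ := by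
      rw [← M.D.funCalc_inv_add_I, ← M.D.funCalc_star]
      congr 1
      ext x
      simp
    rw [← h2] at h1
    obtain ⟨h3, h4⟩ := M.odd ⟨M.D.resolvent.1 y, M.D.resolvent_mem y⟩
    have h5 := h1.apply_of_eq (by norm_num) (-⟨M.γ.1 (M.D.resolvent.1 y), h3⟩) (y := M.γ.1 y) (by
      rw [M.D.op.map_neg, h4]
      conv_rhs => rw [← M.D.resolvent_spec y]
      rw [map_add, neg_neg, M.γ.1.map_smul]
      simp)
    exact h5
  rw [SaRegular.cayley, star_sub, star_one, star_smul, mul_sub, sub_mul, smul_mul_assoc, h,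
    mul_smul_comm, mul_one, one_mul]
  simp

/-- Conjugation on the circle is the reflection `x ↦ -x` of the line. Even functions of `D`
therefore commute with `γ`, and odd ones anticommute. -/
theorem symmetry_mul_funCalc {f : ℝ → ℂ} (hf : VanishesAtInfty f) :
    M.γ * M.D.funCalc f = M.D.funCalc (fun x => f (-x)) * M.γ := by
  have h := conj_symmetry_cfc M.γ_isSelfAdjoint M.γ_sq M.D.isStarNormal_cayley
    M.symmetry_mul_cayley (M.D.continuousOn_circleFun hf)
    (hf.continuousOn_circleFun.mono (by
      rintro _ ⟨z, hz, rfl⟩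
      simpa using M.D.norm_eq_one_of_mem_spectrum_cayley hz))
  have e : (fun z => circleFun f (star z)) = circleFun fun x => f (-x) := by
    ext z
    have : star z = 1 ↔ z = 1 := by rw [star_eq_iff_star_eq, star_one, eq_comm]
    simp only [circleFun, this, invCayley_conj]
  rw [e] at h
  exact h

end KasparovModule

/-! ### Localizing functions -/

namespace IsLocalizing

variable {φ : ℝ → ℝ}

theorem abs_le_one (hφ : IsLocalizing φ) (x : ℝ) : |φ x| ≤ 1 :=
  abs_le.2 ⟨by linarith [(hφ.mem_Icc x).1], (hφ.mem_Icc x).2⟩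

theorem hasCompactSupport (hφ : IsLocalizing φ) : HasCompactSupport φ :=
  isCompact_Icc.of_isClosed_subset (isClosed_tsupport _) hφ.support

theorem hasCompactSupport_comp_div (hφ : IsLocalizing φ) {s : ℝ} (hs : 0 < s) : HasCompactSupport fun x => φ (x / s) := by
  have := hφ.hasCompactSupport.comp_homeomorph (Homeomorph.mulRight₀ s⁻¹ (inv_ne_zero hs.ne'))
  simpa [Function.comp_def, div_eq_mul_inv] using this

theorem vanishesAtInfty (hφ : IsLocalizing φ) {s : ℝ} (hs : 0 < s) : VanishesAtInfty fun x => (φ (x / s) : ℂ) := by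
  have := hφ.continuous
  exact .of_hasCompactSupport (by fun_prop)
    ((hφ.hasCompactSupport_comp_div hs).comp_left (g := Complex.ofReal) rfl)

theorem vanishesAtInfty_mul (hφ : IsLocalizing φ) {s : ℝ} (hs : 0 < s) :
    VanishesAtInfty fun x => (x : ℂ) * (φ (x / s) : ℂ) := by
  have := hφ.continuous
  exact .of_hasCompactSupport (by fun_prop)
    ((hφ.hasCompactSupport_comp_div hs).comp_left (g := Complex.ofReal) rfl).mul_left

theorem eq_one_of_abs_le (hφ : IsLocalizing φ) {s x : ℝ} (hs : 0 < s) (hx : |x| ≤ s / 2) : φ (x / s) = 1 := by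
  have := abs_le.1 hx
  refine hφ.eq_one _ ⟨?_, ?_⟩
  · rw [le_div_iff₀ hs]; linarith
  · rw [div_le_iff₀ hs]; linarith

/-- Where `φ(x/s) ≠ 0` one has `|x| ≤ s`, and there `φ(x/(2s)) = 1`. -/
theorem mul_self_double (hφ : IsLocalizing φ) {s : ℝ} (hs : 0 < s) (x : ℝ) :
    φ (x / (2 * s)) * φ (x / s) = φ (x / s) := by
  by_cases h : φ (x / s) = 0
  · rw [h, mul_zero]
  · have h1 := hφ.support (subset_tsupport _ (Function.mem_support.2 h))
    rw [hφ.eq_one_of_abs_le (by positivity), one_mul]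
    have h2 := h1.1
    have h3 := h1.2
    rw [le_div_iff₀ hs] at h2
    rw [div_le_iff₀ hs] at h3
    rw [abs_le]
    constructor <;> linarith

end IsLocalizing

/-! ### The operators `Φ_s` and the bounded truncations of `D` -/

section Cutoffs

variable (D : SaRegular B X) {φ : ℝ → ℝ}

theorem Phi_double_mul_Phi (hφ : IsLocalizing φ) {s : ℝ} (hs : 0 < s) :
    D.Phi φ (2 * s) * D.Phi φ s = D.Phi φ s := by
  simp only [SaRegular.Phi, SaRegular.calc₀_eq_funCalc]
  rw [← D.funCalc_mul (hφ.vanishesAtInfty (by positivity)) (hφ.vanishesAtInfty hs)]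
  congr 1
  ext x
  rw [← Complex.ofReal_mul, hφ.mul_self_double hs]

theorem isComp_Phi (hφ : IsLocalizing φ) {s : ℝ} (hs : 0 < s) :
    D.IsComp (D.Phi φ s) (D.funCalc fun x => (x : ℂ) * (φ (x / s) : ℂ)) :=
  D.isComp_funCalc (hφ.vanishesAtInfty hs) (hφ.vanishesAtInfty_mul hs)

/-- The truncation of `D` at scale `2s` agrees with `D` on the range of `Φ_s`; this is what lets a
bounded operator replace `D`. -/
theorem funCalc_double_mul_Phi (hφ : IsLocalizing φ) {s : ℝ} (hs : 0 < s) :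
    D.funCalc (fun x => (x : ℂ) * (φ (x / (2 * s)) : ℂ)) * D.Phi φ s =
      D.funCalc fun x => (x : ℂ) * (φ (x / s) : ℂ) := by
  rw [SaRegular.Phi, SaRegular.calc₀_eq_funCalc,
    ← D.funCalc_mul (hφ.vanishesAtInfty_mul (by positivity)) (hφ.vanishesAtInfty hs)]
  congr 1
  ext x
  rw [mul_assoc, ← Complex.ofReal_mul, hφ.mul_self_double hs]

theorem Phi_mem_compacts (hφ : IsLocalizing φ) (hK : D.resolvent ∈ (compacts B X).toSubmodule) {s : ℝ} (hs : 0 < s) :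
    D.Phi φ s ∈ (compacts B X).toSubmodule :=
  D.funCalc_mem_compacts hK (hφ.vanishesAtInfty hs) (hφ.vanishesAtInfty_mul hs)

theorem isSelfAdjoint_Phi (φ : ℝ → ℝ) (s : ℝ) : IsSelfAdjoint (D.Phi φ s) :=
  D.isSelfAdjoint_funCalc (f := fun x => (φ (x / s) : ℂ)) fun _ => Complex.conj_ofReal _

variable [PartialOrder (adjointable B X)] [StarOrderedRing (adjointable B X)]

theorem SaRegular.funCalc_ofReal_nonneg {f : ℝ → ℝ} (hf : ∀ x, 0 ≤ f x) :
    0 ≤ D.funCalc fun x => (f x : ℂ) := by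
  open scoped ComplexOrder in
  refine cfc_nonneg fun z _ => ?_
  by_cases h : z = 1
  · simp [circleFun, h]
  · simpa [circleFun, h] using hf _

theorem Phi_nonneg (hφ : IsLocalizing φ) (s : ℝ) : 0 ≤ D.Phi φ s :=
  D.funCalc_ofReal_nonneg (f := fun x => φ (x / s)) fun _ => (hφ.mem_Icc _).1

theorem one_sub_Phi_nonneg (hφ : IsLocalizing φ) (s : ℝ) : 0 ≤ 1 - D.Phi φ s := by
  have hn : ‖D.Phi φ s‖ ≤ 1 := D.norm_funCalc_le (f := fun x => (φ (x / s) : ℂ)) zero_le_one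
    fun x => (Complex.norm_real _).trans_le (hφ.abs_le_one _)
  exact one_sub_nonneg_of_norm_le_one (Phi_nonneg D hφ s) hn

/-- For `|x| ≤ ρ/2` the factor `1 - φ(x/ρ)` vanishes, and otherwise `x² ≥ (ρ/2)²`. The term `κ²
ρ²/4` of the admissibility condition originates here. -/
theorem Phi_sq_bound (hφ : IsLocalizing φ) {s ρ : ℝ} (hs : 0 < s) (hρ : 0 < ρ) :
    0 ≤ (D.funCalc (fun x => (x : ℂ) * (φ (x / s) : ℂ)) *
      D.funCalc (fun x => (x : ℂ) * (φ (x / s) : ℂ)) -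
        ((ρ / 2) ^ 2) • (D.Phi φ s * D.Phi φ s)) * (1 - D.Phi φ ρ) := by
  have h1 := hφ.vanishesAtInfty_mul hs
  have h2 := hφ.vanishesAtInfty hs
  have h3 := hφ.vanishesAtInfty hρ
  have hv := (h1.mul h1).sub ((h2.mul h2).const_mul ((ρ / 2) ^ 2 : ℝ))
  have e : (D.funCalc (fun x => (x : ℂ) * (φ (x / s) : ℂ)) *
      D.funCalc (fun x => (x : ℂ) * (φ (x / s) : ℂ)) -
        ((ρ / 2) ^ 2) • (D.Phi φ s * D.Phi φ s)) * (1 - D.Phi φ ρ) =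
      D.funCalc fun x => (((x ^ 2 - (ρ / 2) ^ 2) * φ (x / s) ^ 2 * (1 - φ (x / ρ)) : ℝ) : ℂ) := by
    simp only [SaRegular.Phi, SaRegular.calc₀_eq_funCalc]
    rw [← D.funCalc_mul h1 h1, ← D.funCalc_mul h2 h2, ← Complex.coe_smul,
      ← D.funCalc_const_mul (h2.mul h2), ← D.funCalc_sub (h1.mul h1) ((h2.mul h2).const_mul _),
      mul_sub, mul_one, ← D.funCalc_mul hv h3, ← D.funCalc_sub hv (hv.mul h3)]
    congr 1
    ext x
    push_cast
    ring
  rw [e]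
  refine D.funCalc_ofReal_nonneg fun x => ?_
  rcases le_total |x| (ρ / 2) with hx | hx
  · rw [hφ.eq_one_of_abs_le hρ hx, sub_self, mul_zero]
  · have h4 : (ρ / 2) ^ 2 ≤ x ^ 2 := by
      rw [← sq_abs x]
      gcongr
    have h5 := (hφ.mem_Icc (x / ρ)).2
    have h6 := sq_nonneg (φ (x / s))
    exact mul_nonneg (mul_nonneg (by linarith) h6) (by linarith)

end Cutoffs

end

/-! ### Assembly of the path of cycles -/

theorem IsCutoff.isCycle_localizerPath {A : Type*} [CStarAlgebra A] [PartialOrder A]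
    [StarOrderedRing A] {γ H Φ Ψ Ω P K : A} {r : ℝ} (I : ClosedStarIdeal A)
    (h : IsCutoff Φ Ψ Ω P K r)
    (hγ : IsSelfAdjoint γ) (hγγ : γ * γ = 1) (hH : IsSelfAdjoint H) (hHu : IsUnit H)
    (hγH : γ * H = H * γ) (hγΦ : γ * Φ = Φ * γ) (hγΨ : γ * Ψ = Ψ * γ) (hγP : γ * P = P * γ)
    (hγK : γ * K = -(K * γ)) {d : A} (hd : P * (K * H - H * K) * P = P * d * P)
    {ε κ : ℝ} (hκ : 0 < κ) (hε : ‖Φ * H - H * Φ‖ ≤ ε)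
    (hδ : κ * ‖d‖ + 2 * ε * ‖H‖ < min (‖Ring.inverse H‖⁻¹ ^ 2) (κ ^ 2 * r ^ 2))
    (hΦI : Φ ∈ I.toSubmodule) (hΨI : Ψ ∈ I.toSubmodule) (hPI : P ∈ I.toSubmodule) :
    ∀ t ∈ Set.Icc (0 : ℝ) 1, IsSelfAdjoint (localizerPath γ H Φ Ψ P K κ t) ∧
      IsUnit (localizerPath γ H Φ Ψ P K κ t) ∧
      IsCycle I (-γ) (localizerPath γ H Φ Ψ P K κ t) := by
  intro t ht
  have h1 : IsSelfAdjoint (localizerPath γ H Φ Ψ P K κ t) :=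
    isSelfAdjoint_localizerPath hγ hH (h.isSelfAdjoint Φ (by simp)) (h.isSelfAdjoint Ψ (by simp))
      (h.isSelfAdjoint P (by simp)) (h.isSelfAdjoint K (by simp)) hγH hγΨ hγP κ t
  have h2 := h.isUnit_localizerPath hγ hγγ hH hHu hγH hγΦ hγΨ hγP hγK hd hκ hε hδ ht.1 ht.2
  -- Only `1 - F⁴ ≥ 0` is needed, so all parameters are taken to be `0`.
  have h3 := (h.bounds (κ := 0) (g := 0) (δ := 0) (c := 0) ht.1 ht.2 le_rfl le_rfl zero_le_one
    (by simp) (by simp)).2.1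
  exact ⟨h1, h2, isCycle_neg_symmetry I hγ hγγ h1 h2 (localizerPath_add_mem I hΦI hΨI hPI κ h3)⟩

section

variable {B X : Type*} [NonUnitalCStarAlgebra B] [PartialOrder B] [StarOrderedRing B]
  [NormedAddCommGroup X] [NormedSpace ℂ X] [SMul B X] [CStarModule B X] [CompleteSpace X]

/-- A projection between `Φ_ρ` and `Φ_{2ρ}` that commutes with `D`, together with cutoffs of `D`. -/
theorem isCutoff_Phi [PartialOrder (adjointable B X)] [StarOrderedRing (adjointable B X)]
    (D : SaRegular B X) {φ : ℝ → ℝ} (hφ : IsLocalizing φ) {ρ : ℝ} (hρ : 0 < ρ)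
    {P : adjointable B X} (hP : IsStarProjection P) (hPD : D.CommutesWith P)
    (hP₁ : P * D.Phi φ ρ = D.Phi φ ρ) (hP₂ : P * D.Phi φ (2 * ρ) = P) :
    IsCutoff (D.Phi φ ρ) (D.Phi φ (2 * ρ)) (D.Phi φ (2 * (2 * ρ))) P
      (D.funCalc fun x => (x : ℂ) * (φ (x / (2 * (2 * ρ))) : ℂ)) (ρ / 2) where
  isSelfAdjoint := by
    rintro a (rfl | rfl | rfl | rfl | rfl)
    · exact isSelfAdjoint_Phi D φ _
    · exact isSelfAdjoint_Phi D φ _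
    · exact isSelfAdjoint_Phi D φ _
    · exact hP.isSelfAdjoint
    · exact D.isSelfAdjoint_funCalc fun x => by simp
  commute := by
    have hc : ∀ f : ℝ → ℂ, D.funCalc f * P = P * D.funCalc f := fun f =>
      (D.commute_funCalc hP.isSelfAdjoint hPD).eq
    have hor : ∀ a ∈ ({D.Phi φ ρ, D.Phi φ (2 * ρ), D.Phi φ (2 * (2 * ρ)), P,
        D.funCalc fun x => (x : ℂ) * (φ (x / (2 * (2 * ρ))) : ℂ)} : Set (adjointable B X)),
        a = P ∨ ∃ f, a = D.funCalc f := by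
      rintro a (rfl | rfl | rfl | rfl | rfl)
      exacts [.inr ⟨_, D.calc₀_eq_funCalc _⟩, .inr ⟨_, D.calc₀_eq_funCalc _⟩,
        .inr ⟨_, D.calc₀_eq_funCalc _⟩, .inl rfl, .inr ⟨_, rfl⟩]
    intro a ha b hb
    obtain rfl | ⟨f, rfl⟩ := hor a ha <;> obtain rfl | ⟨g, rfl⟩ := hor b hb
    exacts [rfl, (hc g).symm, hc f, D.commute_funCalc_funCalc.eq]
  small_nonneg := Phi_nonneg D hφ _
  small_le_one := one_sub_Phi_nonneg D hφ _
  large_nonneg := Phi_nonneg D hφ _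
  large_le_one := one_sub_Phi_nonneg D hφ _
  proj_mul_proj := hP.isIdempotentElem
  proj_mul_small := hP₁
  proj_mul_large := hP₂
  large_mul_small := Phi_double_mul_Phi D hφ hρ
  cutoff_mul_large := Phi_double_mul_Phi D hφ (by positivity)
  sq_bound := Phi_sq_bound D hφ (by positivity) hρ

theorem KasparovModule.symmetry_mul_Phi (M : KasparovModule B X) {φ : ℝ → ℝ}
    (hφ : IsLocalizing φ) {s : ℝ} (hs : 0 < s) : M.γ * M.D.Phi φ s = M.D.Phi φ s * M.γ := by
  have h := M.symmetry_mul_funCalc (hφ.vanishesAtInfty hs)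
  simp only [neg_div, hφ.even] at h
  exact h

theorem KasparovModule.symmetry_mul_cutoff (M : KasparovModule B X) {φ : ℝ → ℝ}
    (hφ : IsLocalizing φ) {s : ℝ} (hs : 0 < s) :
    M.γ * M.D.funCalc (fun x => (x : ℂ) * (φ (x / s) : ℂ)) =
      -(M.D.funCalc (fun x => (x : ℂ) * (φ (x / s) : ℂ)) * M.γ) := by
  have h := M.symmetry_mul_funCalc (hφ.vanishesAtInfty_mul hs)
  have h' := M.D.funCalc_const_mul (hφ.vanishesAtInfty_mul hs) (-1)
  simp only [neg_div, hφ.even, Complex.ofReal_neg, neg_mul, one_mul, neg_smul, one_smul] at h h'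
  rw [h, h', neg_mul]

end

end
end SpectralLocalizer

/-! ### The proposition -/

open SpectralLocalizer in
theorem propositionp {B X : Type*} [NonUnitalCStarAlgebra B] [PartialOrder B] [StarOrderedRing B]
    [NormedAddCommGroup X] [NormedSpace ℂ X] [SMul B X] [CStarModule B X] [CompleteSpace X]
    (hB : IsSigmaUnital B) (M : KasparovModule B X)
    (H : adjointable B X) (hH_sa : IsSelfAdjoint H) (hH_inv : IsUnit H)
    (hH_even : H * M.γ = M.γ * H) (hH_lip : M.D.IsLipschitz H)
    (φ : ℝ → ℝ) (hφ : IsLocalizing φ) (κ ρ : ℝ) (hκρ : IsAdmissible hH_lip φ κ ρ)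
    (P : adjointable B X) (hP : IsStarProjection P) (hP_even : P * M.γ = M.γ * P)
    (hP_comm : M.D.CommutesWith P)
    (hP₁ : P * M.D.Phi φ ρ = M.D.Phi φ ρ) (hP₂ : P * M.D.Phi φ (2 * ρ) = P) :
    (∃ S, M.D.IsComp (M.D.Phi φ (2 * ρ)) S) ∧
    (∃ S, M.D.IsComp P S) ∧
    IsSelfAdjoint (M.projLocalizer H P κ) ∧
    IsUnit (M.projLocalizer H P κ) ∧
    ∃ (h₁ : IsCycle (compacts B X) (-M.γ) (M.projLocalizer H P κ))
      (h₂ : IsCycle (compacts B X) (-M.γ) (M.localizer H φ κ ρ)),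
      h₁.cls = h₂.cls := by
  obtain ⟨hκ, hρ, hadm⟩ := hκρ
  let _ : PartialOrder (adjointable B X) := CStarAlgebra.spectralOrder _
  have _ : StarOrderedRing (adjointable B X) := CStarAlgebra.spectralOrderedRing _
  have h2ρ : 0 < 2 * ρ := by positivity
  have h4ρ : 0 < 2 * (2 * ρ) := by positivity
  have hcut := isCutoff_Phi M.D hφ hρ hP hP_comm hP₁ hP₂
  -- The scale `4ρ` is one doubling above `2ρ`, so that `K` agrees with `D` on the ranges of
  -- `Φ_{2ρ}` and `P`.
  set K := M.D.funCalc fun x => (x : ℂ) * (φ (x / (2 * (2 * ρ))) : ℂ) with hK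
  have hKsa : IsSelfAdjoint K := hcut.isSelfAdjoint K (by simp)
  have hΨK : M.D.IsComp (M.D.Phi φ (2 * ρ)) (K * M.D.Phi φ (2 * ρ)) := by
    rw [hK, funCalc_double_mul_Phi M.D hφ h2ρ]
    exact isComp_Phi M.D hφ h2ρ
  have hPK : M.D.IsComp P (K * P) := by
    have h := hΨK.mul_right P
    rwa [mul_assoc, hcut.large_mul_proj] at h
  have hε : ‖M.D.Phi φ ρ * H - H * M.D.Phi φ ρ‖ ≤ localConst φ / 2 / ρ * ‖hH_lip.d‖ :=
    M.D.norm_commutator_funCalc_le hφ.continuous hφ.hasCompactSupport hφ.abs_le_one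
      hφ.integrable_fourier hρ hH_lip.isDeriv_d
  -- This is the admissibility condition rearranged: the two commutators of `Φ_ρ` with `H` restore
  -- the full `c_φ`, and `r = ρ/2`.
  have hδ : κ * ‖hH_lip.d‖ + 2 * (localConst φ / 2 / ρ * ‖hH_lip.d‖) * ‖H‖ <
      min (‖Ring.inverse H‖⁻¹ ^ 2) (κ ^ 2 * (ρ / 2) ^ 2) := by
    convert hadm using 2 <;> ring
  have hΦc := Phi_mem_compacts M.D hφ M.resolvent_compact hρ
  have hΨc := Phi_mem_compacts M.D hφ M.resolvent_compact h2ρ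
  have hPc : P ∈ (compacts B X).toSubmodule := hP₂ ▸ (compacts B X).mul_mem_left P hΨc
  have key := hcut.isCycle_localizerPath (compacts B X) M.γ_isSelfAdjoint M.γ_sq hH_sa hH_inv
    hH_even.symm (M.symmetry_mul_Phi hφ hρ) (M.symmetry_mul_Phi hφ h2ρ) hP_even.symm
    (M.symmetry_mul_cutoff hφ h4ρ)
    (SaRegular.compression_commutator hH_lip.isDeriv_d hP.isSelfAdjoint hKsa hPK) hκ hε hδ
    hΦc hΨc hPc
  have e0 : localizerPath M.γ H (M.D.Phi φ ρ) (M.D.Phi φ (2 * ρ)) P K κ 0 =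
      M.localizer H φ κ ρ := by
    rw [localizerPath_zero, KasparovModule.localizer, M.D.comp_eq hΨK, mul_assoc _ K,
      Complex.coe_smul]
  have e1 : localizerPath M.γ H (M.D.Phi φ ρ) (M.D.Phi φ (2 * ρ)) P K κ 1 =
      M.projLocalizer H P κ := by
    rw [localizerPath_one hP.isSelfAdjoint hP.isIdempotentElem hP_even.symm,
      KasparovModule.projLocalizer, M.D.comp_eq hPK, mul_assoc _ K, Complex.coe_smul]
  have hcls := cls_eq_of_path (compacts B X)
    (continuous_localizerPath (γ := M.γ) (H := H) (Φ := M.D.Phi φ ρ) (K := K)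
      (isSelfAdjoint_Phi M.D φ (2 * ρ)) hP.isSelfAdjoint κ) fun t ht => (key t ht).2.2
  have k1 := key 1 (by simp)
  have k0 := (key 0 (by simp)).2.2
  refine ⟨⟨_, hΨK⟩, ⟨_, hPK⟩, ?_⟩
  rw [← e0, ← e1]
  exact ⟨k1.1, k1.2.1, k1.2.2, k0, hcls.symm⟩
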